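/- Let $\alpha\in\mathbb R$ and $\beta>-1$. The class $\mathcal Y_{\alpha,\beta}$ consists of all transcendental (that is, non-rational) meromorphic functions $f$ in $\mathbb C$ such that the family $(f_h)_{|h|\ge 1}$ of functions $$f_h(z)=h^{-\alpha}f(h+h^{-\beta}z)$$ (for any, equivalently one, determination of the powers) is normal in $\mathbb C$, and such that no limit function $\lim_{n\to\infty} f_{h_n}$ with $h_n\to\infty$ is constant (the constant $\infty$ included); convergence is locally uniform in $\mathbb C$ with respect to the spherical metric. Let $m(r,f)$, $N(r,f)$ and $T(r,f)=m(r,f)+N(r,f)$ denote the Nevanlinna proximity function, the integrated counting function of the poles of $f$ with multiplicities, and the Nevanlinna characteristic. Then every $f\in\mathcal Y_{\alpha,\beta}$ satisfies $$m(r,f)+m(r,1/f)=\frac1{2\pi}\int_0^{2\pi}\bigl|\log|f(re^{i\theta})|\bigr|\,d\theta=O(\log r)\qquad(r\to\infty),$$ where the integral converges and the first equality holds for every $r>0$, and, in particular, $$T(r,f)\sim N(r,f)\sim N(r,1/f)\asymp r^{2\beta+2}\qquad(r\to\infty).$$ Here $\phi\sim\psi$ means $\phi(r)/\psi(r)\to1$,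 and $\phi\asymp\psi$ means $\phi=O(\psi)$ and $\psi=O(\phi)$, as $r\to\infty$. -/

import Mathlib

namespace Yosida

/-- The chordal (spherical) distance on the Riemann sphere `OnePoint ℂ`. -/
noncomputable def chordal : OnePoint ℂ → OnePoint ℂ → ℝ
  | OnePoint.some z, OnePoint.some w =>
      2 * ‖z - w‖ / (Real.sqrt (1 + ‖z‖ ^ 2) * Real.sqrt (1 + ‖w‖ ^ 2))
  | OnePoint.some z, OnePoint.infty => 2 / Real.sqrt (1 + ‖z‖ ^ 2)
  | OnePoint.infty, OnePoint.some w => 2 / Real.sqrt (1 + ‖w‖ ^ 2)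
  | OnePoint.infty, OnePoint.infty => 0

/-- A meromorphic function regarded as a map into the Riemann sphere: its value at `z` is the
limit of `f` at `z` in the sphere. The limit exists for every meromorphic `f`; it is `∞` exactly
at the poles, and it does not depend on the values of the representative `f : ℂ → ℂ` on a discrete
set. -/
noncomputable def toSphere (f : ℂ → ℂ) (z : ℂ) : OnePoint ℂ :=
  Filter.limUnder (nhdsWithin z {z}ᶜ) (fun w => (f w : OnePoint ℂ))

/-- Convergence of a sequence of sphere-valued functions, locally uniformly in the plane
(that is, uniformly on compact sets) with respect to the spherical metric. -/
def SphericalTendsto (F : ℕ → ℂ → OnePoint ℂ) (g : ℂ → OnePoint ℂ) : Prop :=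
  ∀ K : Set ℂ, IsCompact K → ∀ ε : ℝ, 0 < ε →
    ∀ᶠ n in Filter.atTop, ∀ z ∈ K, chordal (F n z) (g z) < ε

/-- Normality in the plane of a family of sphere-valued functions: every sequence in the family has
a subsequence that converges locally uniformly in the spherical metric. -/
def IsNormalFamily (𝓕 : Set (ℂ → OnePoint ℂ)) : Prop :=
  ∀ F : ℕ → ℂ → OnePoint ℂ, (∀ n, F n ∈ 𝓕) →
    ∃ φ : ℕ → ℕ, StrictMono φ ∧ ∃ g : ℂ → OnePoint ℂ, SphericalTendsto (F ∘ φ) g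

/-- The rescaled function `f_h(z) = h^{-α} f(h + h^{-β} z)`, with principal powers. Another
determination of the powers changes `f_h` by a unimodular factor and a rotation of the variable,
which affects neither normality nor the constancy of limit functions. -/
noncomputable def rescale (α β : ℝ) (f : ℂ → ℂ) (h : ℂ) : ℂ → ℂ :=
  fun z => h ^ (-(α : ℂ)) * f (h + h ^ (-(β : ℂ)) * z)

/-- The function `f` is rational (up to its values on a discrete closed set). -/
def IsRational (f : ℂ → ℂ) : Prop :=
  ∃ p q : Polynomial ℂ, q ≠ 0 ∧
    f =ᶠ[Filter.codiscrete ℂ] fun z => p.eval z / q.eval z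

/-- Membership in the class `Y_{α,β}` of generalised Yosida functions (for `β > -1`): `f` is a
transcendental meromorphic function in the plane, the family `(f_h)` with `|h| ≥ 1` is normal in the
plane, and no limit function `lim f_{h_n}` with `h_n → ∞` is constant (the constant `∞` included).
-/
structure GeneralisedYosida (α β : ℝ) (f : ℂ → ℂ) : Prop where
  meromorphic : Meromorphic f
  transcendental : ¬ IsRational f
  normal : IsNormalFamily {F | ∃ h : ℂ, 1 ≤ ‖h‖ ∧ F = toSphere (rescale α β f h)}
  limit_nonconstant : ∀ (h : ℕ → ℂ) (g : ℂ → OnePoint ℂ),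
    Filter.Tendsto (fun n => ‖h n‖) Filter.atTop Filter.atTop →
    SphericalTendsto (fun n => toSphere (rescale α β f (h n))) g →
    ¬ ∃ c : OnePoint ℂ, ∀ z, g z = c

/-- The Nevanlinna proximity function `m(r, f)`. -/
noncomputable abbrev m (r : ℝ) (f : ℂ → ℂ) : ℝ := ValueDistribution.proximity f ⊤ r

/-- The integrated counting function `N(r, f)` of the poles of `f`, with multiplicities. -/
noncomputable abbrev N (r : ℝ) (f : ℂ → ℂ) : ℝ := ValueDistribution.logCounting f ⊤ r

/-- The Nevanlinna characteristic `T(r, f) = m(r, f) + N(r, f)`. -/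
noncomputable abbrev T (r : ℝ) (f : ℂ → ℂ) : ℝ := ValueDistribution.characteristic f ⊤ r

end Yosida

/-!
The proof rests on one compactness argument. Normality, together with the absence of constant limit
functions, gives `GeneralisedYosida.exists_discBound`: for every large `h`, on a disc about `h` of
radius comparable with `‖h‖ ^ (-β)`, either `f` is holomorphic with `‖f‖ = O(‖h‖ ^ α)` and is bounded
below by a multiple of `‖h‖ ^ α` off a smaller concentric disc, or the same holds for `1 / f` and
`-α`; all constants are independent of `h`. Otherwise a sequence of rescaled functions without such
bounds would have a nonconstant limit function, which, or whose reciprocal, is holomorphic with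
isolated zeros near the origin.

Jensen's formula on these discs has three consequences. The number of zeros and poles in a disc of
radius `ρ₁ * ‖h‖ ^ (-β)` is bounded; `log ‖f h‖` differs from `α * log ‖h‖` by a bounded amount and a
sum of terms `log (‖h‖ ^ (-β) / ‖u - h‖)` over the zeros and poles `u` near `h`; and
`‖f h‖ = O(‖h‖ ^ α)` if there are no poles near `h`. The last bound and Liouville's theorem show that
no limit function is entire, hence every disc about `h` of radius `R * ‖h‖ ^ (-β)` contains a pole
when `R` is large.

The rest is counting. The annulus of width comparable with `r ^ (-β)` about the circle `‖z‖ = r`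
contains `O(r ^ (β + 1))` zeros and poles, and each logarithmic term has mean `O(r ^ (-β - 1))` over
the circle (`exists_log_kernel`), so the mean of `|log ‖f‖|` is `O(log r)`. The annulus
`r ≤ ‖z‖ ≤ 2 * r` contains `O(r ^ (2 * β + 2))` poles, and at least a positive multiple of
`r ^ (2 * β + 2)` of them, which gives the order of growth of `N r f`. Since `log r` is negligible
against `r ^ (2 * β + 2)`, the asymptotic relations follow from the first main theorem.

Meromorphic functions are handled in normal form, so that `f` is holomorphic exactly where its
order is nonnegative; the last part removes this assumption.
-/

namespace Yosida
open Filter Topology Metric Set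

/-! ### The chordal metric and sphere-valued meromorphic functions -/

/-- The inversion `w ↦ 1 / w` of the Riemann sphere. -/
noncomputable def sphereInv : OnePoint ℂ → OnePoint ℂ
  | OnePoint.some z => if z = 0 then OnePoint.infty else OnePoint.some z⁻¹
  | OnePoint.infty => OnePoint.some 0

theorem sphereInv_infty : sphereInv OnePoint.infty = ((0 : ℂ) : OnePoint ℂ) := rfl

theorem sphereInv_zero : sphereInv ((0 : ℂ) : OnePoint ℂ) = OnePoint.infty := by
  change (if (0 : ℂ) = 0 then OnePoint.infty else OnePoint.some (0 : ℂ)⁻¹) = _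
  simp

theorem sphereInv_coe {z : ℂ} (hz : z ≠ 0) :
    sphereInv (z : OnePoint ℂ) = ((z⁻¹ : ℂ) : OnePoint ℂ) := by
  change (if z = 0 then OnePoint.infty else OnePoint.some z⁻¹) = _
  simp [hz]

theorem sphereInv_sphereInv (p : OnePoint ℂ) : sphereInv (sphereInv p) = p := by
  induction p using OnePoint.rec with
  | infty => rw [sphereInv_infty, sphereInv_zero]
  | coe z =>
    by_cases hz : z = 0
    · rw [hz, sphereInv_zero, sphereInv_infty]
    · rw [sphereInv_coe hz, sphereInv_coe (inv_ne_zero hz), inv_inv]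

theorem chordal_coe_coe (z w : ℂ) : chordal (z : OnePoint ℂ) (w : OnePoint ℂ) =
    2 * ‖z - w‖ / (Real.sqrt (1 + ‖z‖ ^ 2) * Real.sqrt (1 + ‖w‖ ^ 2)) := rfl

theorem chordal_coe_infty (z : ℂ) : chordal (z : OnePoint ℂ) OnePoint.infty =
    2 / Real.sqrt (1 + ‖z‖ ^ 2) := rfl

theorem chordal_infty_infty : chordal OnePoint.infty OnePoint.infty = 0 := rfl

theorem chordal_comm (p q : OnePoint ℂ) : chordal p q = chordal q p := by
  induction p using OnePoint.rec with
  | infty =>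
    induction q using OnePoint.rec with
    | infty => rfl
    | coe w => rfl
  | coe z =>
    induction q using OnePoint.rec with
    | infty => rfl
    | coe w => rw [chordal_coe_coe, chordal_coe_coe, norm_sub_rev, mul_comm (Real.sqrt _)]

theorem sqrt_one_add_norm_inv_sq {z : ℂ} (hz : z ≠ 0) :
    Real.sqrt (1 + ‖z⁻¹‖ ^ 2) = Real.sqrt (1 + ‖z‖ ^ 2) / ‖z‖ := by
  have h : 0 < ‖z‖ := norm_pos_iff.mpr hz
  rw [eq_div_iff h.ne', norm_inv]
  nth_rw 2 [← Real.sqrt_sq h.le]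
  rw [← Real.sqrt_mul (by positivity)]
  congr 1
  field_simp
  ring

/-- Inversion is an isometry for the chordal distance. -/
theorem chordal_sphereInv (p q : OnePoint ℂ) :
    chordal (sphereInv p) (sphereInv q) = chordal p q := by
  have key : ∀ z : ℂ, chordal (sphereInv z) (sphereInv OnePoint.infty) =
      chordal (z : OnePoint ℂ) OnePoint.infty := by
    intro z
    rw [sphereInv_infty]
    by_cases hz : z = 0
    · rw [hz, sphereInv_zero]; rfl
    · have h : 0 < ‖z‖ := norm_pos_iff.mpr hz
      rw [sphereInv_coe hz, chordal_coe_coe, chordal_coe_infty, sqrt_one_add_norm_inv_sq hz]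
      simp only [sub_zero, norm_inv, norm_zero]
      norm_num
      field_simp
  have key0 : ∀ z : ℂ, chordal (sphereInv z) (sphereInv (0 : ℂ)) =
      chordal (z : OnePoint ℂ) (0 : ℂ) := by
    intro z
    rw [sphereInv_zero]
    by_cases hz : z = 0
    · rw [hz, sphereInv_zero, chordal_infty_infty, chordal_coe_coe]; simp
    · have h : 0 < ‖z‖ := norm_pos_iff.mpr hz
      rw [sphereInv_coe hz, chordal_coe_coe, chordal_coe_infty, sqrt_one_add_norm_inv_sq hz]
      simp only [sub_zero, norm_zero]
      norm_num
      field_simp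
  induction p using OnePoint.rec with
  | infty =>
    induction q using OnePoint.rec with
    | infty =>
      rw [sphereInv_infty, chordal_coe_coe, chordal_infty_infty]; simp
    | coe w => rw [chordal_comm, key, chordal_comm]
  | coe z =>
    induction q using OnePoint.rec with
    | infty => exact key z
    | coe w =>
      by_cases hw : w = 0
      · rw [hw, key0]
      by_cases hz : z = 0
      · rw [hz, chordal_comm, key0, chordal_comm]
      have h1 : 0 < ‖z‖ := norm_pos_iff.mpr hz
      have h2 : 0 < ‖w‖ := norm_pos_iff.mpr hw
      rw [sphereInv_coe hz, sphereInv_coe hw, chordal_coe_coe, chordal_coe_coe,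
        sqrt_one_add_norm_inv_sq hz, sqrt_one_add_norm_inv_sq hw,
        inv_sub_inv hz hw, norm_div, norm_mul, norm_sub_rev w z]
      field_simp

/-- A point of the sphere that is chordally close to a bounded point of the plane lies in the plane,
and is close to it in the Euclidean distance. -/
theorem exists_coe_of_chordal_lt {v : ℂ} {q : OnePoint ℂ} {M ε : ℝ} (hv : ‖v‖ ≤ M)
    (hε : ε * Real.sqrt (1 + M ^ 2) ≤ 1) (h : chordal v q < ε) :
    ∃ u : ℂ, q = u ∧ ‖v - u‖ ≤ ε * (1 + M ^ 2) := by
  set A := Real.sqrt (1 + M ^ 2) with hA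
  have hA2 : A ^ 2 = 1 + M ^ 2 := Real.sq_sqrt (by positivity)
  have hA0 : 0 < A := Real.sqrt_pos.mpr (by positivity)
  have hvA : Real.sqrt (1 + ‖v‖ ^ 2) ≤ A := by
    apply Real.sqrt_le_sqrt
    gcongr
  have hv0 : 0 < Real.sqrt (1 + ‖v‖ ^ 2) := Real.sqrt_pos.mpr (by positivity)
  induction q using OnePoint.rec with
  | infty =>
    rw [chordal_coe_infty, div_lt_iff₀ hv0] at h
    have hε0 : 0 < ε := by
      by_contra hc
      nlinarith
    nlinarith
  | coe u =>
    refine ⟨u, rfl, ?_⟩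
    have hu0 : 0 < Real.sqrt (1 + ‖u‖ ^ 2) := Real.sqrt_pos.mpr (by positivity)
    rw [chordal_coe_coe, div_lt_iff₀ (by positivity)] at h
    have hε0 : 0 < ε := by
      by_contra hc
      have := norm_nonneg (v - u)
      have h3 : 0 < Real.sqrt (1 + ‖v‖ ^ 2) * Real.sqrt (1 + ‖u‖ ^ 2) := by positivity
      nlinarith
    have hu : Real.sqrt (1 + ‖u‖ ^ 2) ≤ A + ‖v - u‖ := by
      rw [Real.sqrt_le_left (by positivity)]
      have h1 : ‖u‖ ≤ ‖v‖ + ‖v - u‖ := by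
        have := norm_sub_le v (v - u)
        simpa using this
      have h2 : ‖u‖ ≤ M + ‖v - u‖ := by linarith
      have hMA : M ≤ A := by
        have : 0 ≤ M := (norm_nonneg _).trans hv
        nlinarith
      have := norm_nonneg (v - u)
      have := norm_nonneg u
      nlinarith
    have h4 : Real.sqrt (1 + ‖v‖ ^ 2) * Real.sqrt (1 + ‖u‖ ^ 2) ≤ A * (A + ‖v - u‖) := by
      gcongr
    have h5 := mul_le_mul_of_nonneg_left h4 hε0.le
    have h6 : ε * A * ‖v - u‖ ≤ 1 * ‖v - u‖ :=
      mul_le_mul_of_nonneg_right hε (norm_nonneg _)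
    nlinarith

theorem toSphere_of_tendsto {F : ℂ → ℂ} {z c : ℂ} (h : Tendsto F (𝓝[≠] z) (𝓝 c)) :
    toSphere F z = c :=
  (((OnePoint.continuous_coe.tendsto c).comp h)).limUnder_eq

theorem toSphere_of_order_neg {F : ℂ → ℂ} {z : ℂ} (h : meromorphicOrderAt F z < 0) :
    toSphere F z = OnePoint.infty := by
  have h1 := tendsto_cobounded_of_meromorphicOrderAt_neg h
  rw [Metric.cobounded_eq_cocompact] at h1
  refine Tendsto.limUnder_eq ?_
  have h2 := OnePoint.tendsto_coe_infty (X := ℂ)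
  rw [Filter.coclosedCompact_eq_cocompact] at h2
  exact h2.comp h1

theorem toSphere_of_analyticAt {F : ℂ → ℂ} {z : ℂ} (h : AnalyticAt ℂ F z) :
    toSphere F z = F z :=
  toSphere_of_tendsto (h.continuousAt.tendsto.mono_left nhdsWithin_le_nhds)

theorem toSphere_congr {F G : ℂ → ℂ} {z : ℂ} (h : F =ᶠ[𝓝[≠] z] G) :
    toSphere F z = toSphere G z := by
  unfold toSphere limUnder
  congr 1
  exact Filter.map_congr (h.mono fun w hw => congrArg _ hw)

theorem analyticAt_of_toSphere_eq_coe {F : ℂ → ℂ} {z v : ℂ} (hF : MeromorphicNFAt F z)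
    (h : toSphere F z = v) : AnalyticAt ℂ F z ∧ F z = v := by
  have h1 : 0 ≤ meromorphicOrderAt F z := by
    by_contra hc
    rw [toSphere_of_order_neg (not_le.mp hc)] at h
    exact OnePoint.infty_ne_coe _ h
  have h2 := hF.meromorphicOrderAt_nonneg_iff_analyticAt.mp h1
  refine ⟨h2, ?_⟩
  rw [toSphere_of_analyticAt h2] at h
  exact OnePoint.coe_injective h

theorem toSphere_inv {F : ℂ → ℂ} {z : ℂ} (hm : MeromorphicAt F z)
    (ht : meromorphicOrderAt F z ≠ ⊤) :
    toSphere F⁻¹ z = sphereInv (toSphere F z) := by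
  rcases lt_trichotomy (meromorphicOrderAt F z) 0 with h | h | h
  · rw [toSphere_of_order_neg h, sphereInv_infty]
    apply toSphere_of_tendsto
    exact tendsto_inv₀_cobounded.comp (tendsto_cobounded_of_meromorphicOrderAt_neg h)
  · obtain ⟨c, hc, hcl⟩ := tendsto_ne_zero_of_meromorphicOrderAt_eq_zero hm h
    rw [toSphere_of_tendsto hcl, sphereInv_coe hc]
    exact toSphere_of_tendsto (hcl.inv₀ hc)
  · rw [toSphere_of_tendsto (tendsto_zero_of_meromorphicOrderAt_pos h), sphereInv_zero]
    apply toSphere_of_order_neg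
    rw [meromorphicOrderAt_inv]
    lift meromorphicOrderAt F z to ℤ using ht with n hn
    norm_cast at h ⊢
    omega

end Yosida

namespace Yosida
open Filter Topology Metric Set

/-! ### Spherical limits of meromorphic functions -/

/-- The sequence `F` consists of meromorphic functions in normal form, none of which vanishes
identically, and it converges to `g` locally uniformly in the spherical metric. -/
structure LimitOf (F : ℕ → ℂ → ℂ) (g : ℂ → OnePoint ℂ) : Prop where
  nf : ∀ n z, MeromorphicNFAt (F n) z
  order : ∀ n z, meromorphicOrderAt (F n) z ≠ ⊤
  tendsto : SphericalTendsto (fun n => toSphere (F n)) g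

variable {F : ℕ → ℂ → ℂ} {g : ℂ → OnePoint ℂ}

theorem LimitOf.inv (h : LimitOf F g) :
    LimitOf (fun n => (F n)⁻¹) (fun z => sphereInv (g z)) where
  nf n z := (h.nf n z).inv
  order n z := by
    rw [meromorphicOrderAt_inv]
    simpa using h.order n z
  tendsto K hK ε hε := by
    filter_upwards [h.tendsto K hK ε hε] with n hn z hz
    rw [toSphere_inv (h.nf n z).meromorphicAt (h.order n z), chordal_sphereInv]
    exact hn z hz

theorem exists_coe_norm_le_one (p : OnePoint ℂ) :
    (∃ u : ℂ, p = u ∧ ‖u‖ ≤ 1) ∨ ∃ u : ℂ, sphereInv p = u ∧ ‖u‖ ≤ 1 := by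
  induction p using OnePoint.rec with
  | infty => exact Or.inr ⟨0, rfl, by simp⟩
  | coe z =>
    rcases le_total ‖z‖ 1 with h | h
    · exact Or.inl ⟨z, rfl, h⟩
    · have hz : z ≠ 0 := norm_pos_iff.mp (by linarith)
      refine Or.inr ⟨z⁻¹, sphereInv_coe hz, ?_⟩
      rw [norm_inv]
      exact inv_le_one_of_one_le₀ h

/-- Where the limit is bounded by `1`, the sequence is eventually bounded nearby. -/
theorem LimitOf.bounded_near (h : LimitOf F g) {w u : ℂ} (hu : g w = u) (hu1 : ‖u‖ ≤ 1) :
    ∃ s > 0, ∀ᶠ n in atTop, ∀ z ∈ ball w s, AnalyticAt ℂ (F n) z ∧ ‖F n z‖ ≤ 3 := by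
  have hsq : ∀ M : ℝ, 0 ≤ M → M ≤ 2 → 1 / 1000 * Real.sqrt (1 + M ^ 2) ≤ 1 := by
    intro M h0 hM
    have : Real.sqrt (1 + M ^ 2) ≤ 3 := by
      rw [Real.sqrt_le_left (by norm_num)]
      nlinarith
    linarith
  obtain ⟨N, hN⟩ := eventually_atTop.mp
    (h.tendsto (closedBall w 1) (isCompact_closedBall w 1) (1 / 1000) (by norm_num))
  obtain ⟨v, hv, hvu⟩ := exists_coe_of_chordal_lt (v := u) (q := toSphere (F N) w) (M := 1)
    (ε := 1 / 1000) hu1 (hsq 1 (by norm_num) (by norm_num)) (by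
      rw [chordal_comm, ← hu]
      exact hN N le_rfl w (by simp))
  obtain ⟨ha, hFv⟩ := analyticAt_of_toSphere_eq_coe (h.nf N w) hv
  have hv2 : ‖F N w‖ < 3 / 2 := by
    have := norm_sub_norm_le v u
    rw [norm_sub_rev] at this
    rw [hFv]
    linarith
  have hev : ∀ᶠ z in 𝓝 w, AnalyticAt ℂ (F N) z ∧ ‖F N z‖ < 3 / 2 :=
    ha.eventually_analyticAt.and (ha.continuousAt.norm.eventually_lt continuousAt_const hv2)
  obtain ⟨s, hs, hsb⟩ := Metric.eventually_nhds_iff_ball.mp hev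
  refine ⟨min s 1, by positivity, eventually_atTop.mpr ⟨N, fun n hn z hz => ?_⟩⟩
  have hzs : z ∈ ball w s := ball_subset_ball (min_le_left _ _) hz
  have hz1 : z ∈ closedBall w 1 :=
    ball_subset_closedBall (ball_subset_ball (min_le_right _ _) hz)
  obtain ⟨ha', hb'⟩ := hsb z hzs
  obtain ⟨u', hu', huv'⟩ := exists_coe_of_chordal_lt (v := F N z) (q := g z) (M := 3 / 2)
    (ε := 1 / 1000) hb'.le (hsq _ (by norm_num) (by norm_num)) (by
      rw [← toSphere_of_analyticAt ha']
      exact hN N le_rfl z hz1)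
  have hu2 : ‖u'‖ ≤ 2 := by
    have := norm_sub_norm_le u' (F N z)
    rw [norm_sub_rev] at this
    linarith
  obtain ⟨v', hv', hvv'⟩ := exists_coe_of_chordal_lt (v := u') (q := toSphere (F n) z) (M := 2)
    (ε := 1 / 1000) hu2 (hsq _ (by norm_num) (by norm_num)) (by
      rw [chordal_comm, ← hu']
      exact hN n hn z hz1)
  obtain ⟨ha2, hF2⟩ := analyticAt_of_toSphere_eq_coe (h.nf n z) hv'
  refine ⟨ha2, ?_⟩
  have := norm_sub_norm_le v' u'
  rw [norm_sub_rev] at this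
  rw [hF2]
  linarith

/-- On an open set where the sequence is eventually bounded, the limit is a holomorphic function,
and the convergence is locally uniform in the Euclidean metric. -/
theorem LimitOf.analytic_limit (h : LimitOf F g) {U : Set ℂ} (hU : IsOpen U) {M : ℝ}
    (hM : ∀ᶠ n in atTop, ∀ z ∈ U, AnalyticAt ℂ (F n) z ∧ ‖F n z‖ ≤ M) :
    ∃ G : ℂ → ℂ, DifferentiableOn ℂ G U ∧ (∀ z ∈ U, g z = G z) ∧ (∀ z ∈ U, ‖G z‖ ≤ M) ∧
      ∀ K ⊆ U, IsCompact K → TendstoUniformlyOn F G atTop K := by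
  classical
  have hA0 : 0 < Real.sqrt (1 + M ^ 2) := Real.sqrt_pos.mpr (by positivity)
  have key : ∀ K ⊆ U, IsCompact K → ∀ δ > 0, ∀ᶠ n in atTop, ∀ z ∈ K,
      ∃ u : ℂ, g z = u ∧ ‖F n z - u‖ < δ := by
    intro K hKU hK δ hδ
    set ε := min (δ / (2 * (1 + M ^ 2))) (Real.sqrt (1 + M ^ 2))⁻¹ with hε
    have hε0 : 0 < ε := by positivity
    have h1 : ε * Real.sqrt (1 + M ^ 2) ≤ 1 := by
      rw [← le_div_iff₀ hA0, one_div]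
      exact min_le_right _ _
    have h2 : ε * (1 + M ^ 2) < δ := by
      have : ε * (2 * (1 + M ^ 2)) ≤ δ := by
        rw [← le_div_iff₀ (by positivity)]
        exact min_le_left _ _
      nlinarith
    filter_upwards [hM, h.tendsto K hK ε hε0] with n hn hn' z hz
    obtain ⟨ha, hb⟩ := hn z (hKU hz)
    obtain ⟨u, hu, huv⟩ := exists_coe_of_chordal_lt (v := F n z) (q := g z) hb h1 (by
      rw [← toSphere_of_analyticAt ha]
      exact hn' z hz)
    exact ⟨u, hu, huv.trans_lt h2⟩
  have hex : ∀ z ∈ U, ∃ u : ℂ, g z = u := by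
    intro z hz
    obtain ⟨n, hn⟩ := (key {z} (by simpa using hz) isCompact_singleton 1 one_pos).exists
    obtain ⟨u, hu, -⟩ := hn z rfl
    exact ⟨u, hu⟩
  choose! G hG using hex
  have hunif : ∀ K ⊆ U, IsCompact K → TendstoUniformlyOn F G atTop K := by
    intro K hKU hK
    rw [Metric.tendstoUniformlyOn_iff]
    intro δ hδ
    filter_upwards [key K hKU hK δ hδ] with n hn z hz
    obtain ⟨u, hu, huv⟩ := hn z hz
    rw [hG z (hKU hz)] at hu
    rw [OnePoint.coe_injective hu, dist_comm, dist_eq_norm]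
    exact huv
  refine ⟨G, ?_, hG, ?_, hunif⟩
  · refine TendstoLocallyUniformlyOn.differentiableOn (F := F) (φ := atTop) ?_ ?_ hU
    · exact (tendstoLocallyUniformlyOn_iff_forall_isCompact hU).mpr hunif
    · exact hM.mono fun n hn z hz => (hn z hz).1.differentiableAt.differentiableWithinAt
  · intro z hz
    have h1 := (hunif {z} (by simpa using hz) isCompact_singleton).tendsto_at (mem_singleton z)
    exact le_of_tendsto h1.norm (hM.mono fun n hn => (hn z hz).2)

/-- Locally, the limit or its inversion is a holomorphic function. -/
theorem LimitOf.exists_local_rep (h : LimitOf F g) (w : ℂ) :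
    ∃ s > 0, ∃ G : ℂ → ℂ, DifferentiableOn ℂ G (ball w s) ∧
      ((∀ z ∈ ball w s, g z = G z) ∨ ∀ z ∈ ball w s, sphereInv (g z) = G z) := by
  rcases exists_coe_norm_le_one (g w) with ⟨u, hu, hu1⟩ | ⟨u, hu, hu1⟩
  · obtain ⟨s, hs, hb⟩ := h.bounded_near hu hu1
    obtain ⟨G, hG, hgG, -⟩ := h.analytic_limit isOpen_ball hb
    exact ⟨s, hs, G, hG, Or.inl hgG⟩
  · obtain ⟨s, hs, hb⟩ := h.inv.bounded_near hu hu1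
    obtain ⟨G, hG, hgG, -⟩ := h.inv.analytic_limit isOpen_ball hb
    exact ⟨s, hs, G, hG, Or.inr hgG⟩

/-- Identity theorem: a spherical limit that is constant near a point is constant. -/
theorem LimitOf.not_eventually_const (h : LimitOf F g) (hg : ¬ ∃ c : OnePoint ℂ, ∀ z, g z = c)
    (w : ℂ) : ¬ ∀ᶠ z in 𝓝 w, g z = g w := by
  set V : Set ℂ := {w | ∀ᶠ z in 𝓝 w, g z = g w} with hV
  have hVopen : IsOpen V := by
    rw [isOpen_iff_mem_nhds]
    intro x hx
    have hx' : ∀ᶠ z in 𝓝 x, g z = g x := hx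
    filter_upwards [hx'.eventually_nhds, hx'] with y hy hyx
    exact hy.mono fun z hz => hz.trans hyx.symm
  have hVclosed : IsClosed V := by
    rw [← isOpen_compl_iff, isOpen_iff_mem_nhds]
    intro x hx
    obtain ⟨s, hs, G, hG, hrep⟩ := h.exists_local_rep x
    have hGan : AnalyticOnNhd ℂ G (ball x s) := hG.analyticOnNhd isOpen_ball
    have hiff : ∀ y ∈ ball x s, ∀ z ∈ ball x s, (g y = g z ↔ G y = G z) := by
      intro y hy z hz
      rcases hrep with hr | hr
      · rw [hr y hy, hr z hz]
        exact OnePoint.coe_injective.eq_iff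
      · have e := (OnePoint.coe_injective (X := ℂ)).eq_iff (a := G y) (b := G z)
        rw [← hr y hy, ← hr z hz] at e
        rw [← e]
        exact (Function.LeftInverse.injective sphereInv_sphereInv).eq_iff.symm
    filter_upwards [ball_mem_nhds x hs] with y hy hyV
    apply hx
    have hyV' : ∀ᶠ z in 𝓝 y, g z = g y := hyV
    have h1 : G =ᶠ[𝓝 y] fun _ => G y := by
      filter_upwards [hyV', isOpen_ball.mem_nhds hy] with z hz hzb
      exact (hiff z hzb y hy).mp hz
    have h2 := hGan.eqOn_of_preconnected_of_eventuallyEq analyticOnNhd_const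
      (convex_ball x s).isPreconnected hy h1
    have h3 : ∀ᶠ z in 𝓝 x, g z = g x := by
      filter_upwards [ball_mem_nhds x hs] with z hz
      exact (hiff z hz x (mem_ball_self hs)).mpr ((h2 hz).trans (h2 (mem_ball_self hs)).symm)
    exact h3
  intro hw
  have huniv : V = univ := IsClopen.eq_univ ⟨hVclosed, hVopen⟩ ⟨w, hw⟩
  have hloc : IsLocallyConstant g := by
    rw [IsLocallyConstant.iff_eventually_eq]
    intro x
    have : x ∈ V := huniv ▸ mem_univ x
    exact this
  exact hg ⟨g 0, fun z => hloc.apply_eq_of_preconnectedSpace z 0⟩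

/-- If a nonconstant limit is bounded by `1` at the origin, then on some disc about the origin the
sequence is eventually holomorphic and bounded, and bounded away from zero off a smaller concentric
disc. -/
theorem LimitOf.bounds_near_zero (h : LimitOf F g) (hg : ¬ ∃ c : OnePoint ℂ, ∀ z, g z = c)
    {u : ℂ} (hu : g 0 = u) (hu1 : ‖u‖ ≤ 1) :
    ∃ ρ M : ℝ, 0 < ρ ∧ ρ ≤ 1 ∧ 1 ≤ M ∧ ∀ᶠ n in atTop, ∀ z ∈ closedBall (0 : ℂ) ρ,
      AnalyticAt ℂ (F n) z ∧ ‖F n z‖ ≤ M ∧ (ρ / 8 ≤ ‖z‖ → M⁻¹ ≤ ‖F n z‖) := by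
  obtain ⟨s, hs, hb⟩ := h.bounded_near hu hu1
  obtain ⟨G, hG, hgG, -, hunif⟩ := h.analytic_limit isOpen_ball hb
  have hGan : AnalyticOnNhd ℂ G (ball 0 s) := hG.analyticOnNhd isOpen_ball
  have hne : ∀ᶠ z in 𝓝[≠] (0 : ℂ), G z ≠ 0 := by
    rcases (hGan 0 (mem_ball_self hs)).eventually_eq_zero_or_eventually_ne_zero with h0 | h0
    · exfalso
      apply h.not_eventually_const hg 0
      filter_upwards [h0, ball_mem_nhds (0 : ℂ) hs] with z hz hzb
      rw [hgG z hzb, hgG 0 (mem_ball_self hs), hz, h0.self_of_nhds]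
    · exact h0
  rw [eventually_nhdsWithin_iff, Metric.eventually_nhds_iff_ball] at hne
  obtain ⟨t, ht, hne⟩ := hne
  set ρ := min (min s t / 2) 1 with hρ
  have hρ0 : 0 < ρ := by positivity
  have hρs : ρ < s := by
    have h1 : ρ ≤ min s t / 2 := min_le_left _ _
    have h2 : min s t ≤ s := min_le_left _ _
    linarith
  have hρt : ρ < t := by
    have h1 : ρ ≤ min s t / 2 := min_le_left _ _
    have h2 : min s t ≤ t := min_le_right _ _
    linarith
  have hsub : closedBall (0 : ℂ) ρ ⊆ ball 0 s := closedBall_subset_ball hρs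
  set K : Set ℂ := closedBall 0 ρ ∩ {z | ρ / 8 ≤ ‖z‖} with hK
  have hKc : IsCompact K :=
    (isCompact_closedBall 0 ρ).inter_right (isClosed_le continuous_const continuous_norm)
  have hKs : K ⊆ ball 0 s := fun z hz => hsub hz.1
  have hpos : ∀ z ∈ K, 0 < ‖G z‖ := by
    intro z hz
    refine norm_pos_iff.mpr (hne z (closedBall_subset_ball hρt hz.1) ?_)
    have h1 : ρ / 8 ≤ ‖z‖ := hz.2
    exact norm_pos_iff.mp (by linarith)
  obtain ⟨m, hm, hmK⟩ := hKc.exists_forall_le' (hG.continuousOn.mono hKs).norm hpos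
  refine ⟨ρ, max 3 (2 / m), hρ0, min_le_right _ _, le_max_of_le_left (by norm_num), ?_⟩
  have h1 := Metric.tendstoUniformlyOn_iff.mp (hunif K hKs hKc) (m / 2) (by positivity)
  filter_upwards [hb, h1] with n hn hn' z hz
  refine ⟨(hn z (hsub hz)).1, (hn z (hsub hz)).2.trans (le_max_left _ _), fun hz8 => ?_⟩
  have h2 := hn' z ⟨hz, hz8⟩
  rw [dist_eq_norm] at h2
  have h3 := hmK z ⟨hz, hz8⟩
  have h4 := norm_sub_norm_le (G z) (F n z)
  have h5 : m / 2 ≤ ‖F n z‖ := by linarith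
  refine le_trans ?_ h5
  calc (max 3 (2 / m))⁻¹ ≤ (2 / m)⁻¹ := inv_anti₀ (by positivity) (le_max_right _ _)
    _ = m / 2 := by rw [inv_div]

end Yosida

namespace Yosida
open Filter Topology Metric Set

/-! ### Uniform bounds on discs of the natural scale -/

/-- On the disc about `h` of radius `r` the function `k` is holomorphic with `‖k‖ ≤ M * B`, and
`‖k‖ ≥ B / M` off the concentric disc of radius `r / 8`. -/
def DiscBound (k : ℂ → ℂ) (B : ℝ) (h : ℂ) (r M : ℝ) : Prop :=
  ∀ w ∈ closedBall h r, AnalyticAt ℂ k w ∧ ‖k w‖ ≤ M * B ∧ (r / 8 ≤ ‖w - h‖ → M⁻¹ * B ≤ ‖k w‖)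

section affine

variable {k : ℂ → ℂ} {c d h z : ℂ}

theorem analyticAt_add_mul (h d z : ℂ) : AnalyticAt ℂ (fun z => h + d * z) z := by fun_prop

theorem deriv_add_mul_ne_zero (h : ℂ) (hd : d ≠ 0) (z : ℂ) :
    deriv (fun z : ℂ => h + d * z) z ≠ 0 := by
  simpa using hd

theorem analyticAt_of_mul_comp_affine (hc : c ≠ 0) (hd : d ≠ 0)
    (ha : AnalyticAt ℂ (fun z => c * k (h + d * z)) z) : AnalyticAt ℂ k (h + d * z) := by
  have h1 : AnalyticAt ℂ (k ∘ fun z => h + d * z) z := by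
    have h2 : AnalyticAt ℂ (fun z => c⁻¹ * (c * k (h + d * z))) z := by fun_prop
    refine h2.congr (Eventually.of_forall fun x => ?_)
    simp [hc]
  exact (analyticAt_comp_iff_of_deriv_ne_zero (analyticAt_add_mul h d z)
    (deriv_add_mul_ne_zero h hd z)).mp h1

theorem meromorphicNFAt_mul_comp_affine (hc : c ≠ 0) (hk : MeromorphicNFAt k (h + d * z)) :
    MeromorphicNFAt (fun z => c * k (h + d * z)) z :=
  (meromorphicNFAt_mul_iff_right (g := fun _ => c) analyticAt_const hc).mpr
    (hk.comp_analyticAt (g := fun z => h + d * z) (analyticAt_add_mul h d z))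

theorem meromorphicOrderAt_mul_comp_affine (hc : c ≠ 0) (hd : d ≠ 0) :
    meromorphicOrderAt (fun z => c * k (h + d * z)) z = meromorphicOrderAt k (h + d * z) := by
  have h1 := meromorphicOrderAt_mul_of_ne_zero (g := fun _ => c)
    (f := k ∘ fun z => h + d * z) (x := z) analyticAt_const hc
  rw [meromorphicOrderAt_comp_of_deriv_ne_zero (analyticAt_add_mul h d z)
    (deriv_add_mul_ne_zero h hd z)] at h1
  exact h1

/-- Bounds for a rescaled function on a disc about the origin, read as bounds for the function. -/
theorem DiscBound.of_affine (hc : c ≠ 0) (hd : d ≠ 0) {ρ M : ℝ}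
    (hb : ∀ z ∈ closedBall (0 : ℂ) ρ, AnalyticAt ℂ (fun z => c * k (h + d * z)) z ∧
      ‖c * k (h + d * z)‖ ≤ M ∧ (ρ / 8 ≤ ‖z‖ → M⁻¹ ≤ ‖c * k (h + d * z)‖)) :
    DiscBound k ‖c‖⁻¹ h (ρ * ‖d‖) M := by
  intro w hw
  have hd0 : 0 < ‖d‖ := norm_pos_iff.mpr hd
  have hc0 : 0 < ‖c‖ := norm_pos_iff.mpr hc
  set z := (w - h) / d with hz
  have hwz : h + d * z = w := by rw [hz, mul_div_cancel₀ _ hd]; ring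
  have hzn : ‖z‖ = ‖w - h‖ / ‖d‖ := norm_div _ _
  rw [mem_closedBall, dist_eq_norm] at hw
  have hzρ : z ∈ closedBall (0 : ℂ) ρ := by
    rw [mem_closedBall_zero_iff, hzn, div_le_iff₀ hd0]
    exact hw
  obtain ⟨h1, h2, h3⟩ := hb z hzρ
  rw [hwz, norm_mul] at h2 h3
  refine ⟨hwz ▸ analyticAt_of_mul_comp_affine hc hd h1, ?_, fun h8 => ?_⟩
  · rw [← div_eq_mul_inv, le_div_iff₀ hc0, mul_comm]
    exact h2
  · have h4 : M⁻¹ ≤ ‖c‖ * ‖k w‖ := by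
      apply h3
      rw [hzn, le_div_iff₀ hd0]
      linarith
    rw [← div_eq_mul_inv, div_le_iff₀ hc0, mul_comm]
    exact h4

end affine

theorem DiscBound.mono {k : ℂ → ℂ} {B r M M' : ℝ} {h : ℂ} (hk : DiscBound k B h r M) (hB : 0 ≤ B)
    (hM : 0 < M) (hMM : M ≤ M') : DiscBound k B h r M' := by
  intro w hw
  obtain ⟨h1, h2, h3⟩ := hk w hw
  exact ⟨h1, h2.trans (by gcongr), fun h8 => le_trans (by gcongr) (h3 h8)⟩

theorem norm_cpow_ofReal {h : ℂ} (hh : h ≠ 0) (a : ℝ) : ‖h ^ (a : ℂ)‖ = ‖h‖ ^ a := by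
  rw [Complex.norm_cpow_of_ne_zero hh]
  simp

theorem norm_cpow_neg_ofReal {h : ℂ} (hh : h ≠ 0) (a : ℝ) : ‖h ^ (-(a : ℂ))‖ = ‖h‖ ^ (-a) := by
  rw [← Complex.ofReal_neg, norm_cpow_ofReal hh]

theorem cpow_ne_zero_of_ne_zero {h : ℂ} (hh : h ≠ 0) (a : ℂ) : h ^ a ≠ 0 := by
  simp [Complex.cpow_eq_zero_iff, hh]

variable {α β : ℝ} {f : ℂ → ℂ}

/-- A function of the class does not vanish identically near any point. -/
theorem GeneralisedYosida.order_ne_top (hf : GeneralisedYosida α β f) (z : ℂ) :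
    meromorphicOrderAt f z ≠ ⊤ := by
  intro hz
  have hall : ∀ w, meromorphicOrderAt f w = ⊤ := by
    intro w
    by_contra hw
    exact (meromorphicOn_univ.mpr hf.meromorphic).meromorphicOrderAt_ne_top_of_isPreconnected
      isPreconnected_univ (mem_univ w) (mem_univ z) hw hz
  refine hf.transcendental ⟨0, 1, one_ne_zero, ?_⟩
  have : {w | f w = 0} ∈ codiscrete ℂ := by
    refine mem_codiscreteWithin_iff_forall_mem_nhdsNE.mpr fun x _ => ?_
    filter_upwards [meromorphicOrderAt_eq_top_iff.mp (hall x)] with w hw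
    exact Or.inl hw
  filter_upwards [this] with w hw
  simpa using hw

/-- A sequence `h n → ∞` has a subsequence along which the rescaled functions converge to a
nonconstant limit. -/
theorem GeneralisedYosida.exists_limit (hf : GeneralisedYosida α β f)
    (hnf : ∀ z, MeromorphicNFAt f z) {h : ℕ → ℂ} (hh : ∀ n : ℕ, (n : ℝ) + 1 ≤ ‖h n‖) :
    ∃ φ : ℕ → ℕ, StrictMono φ ∧ ∃ g : ℂ → OnePoint ℂ,
      LimitOf (fun n => rescale α β f (h (φ n))) g ∧ ¬ ∃ c : OnePoint ℂ, ∀ z, g z = c := by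
  have h1 : ∀ n, 1 ≤ ‖h n‖ := fun n => by
    have := hh n
    have : (0 : ℝ) ≤ n := n.cast_nonneg
    linarith
  have h0 : ∀ n, h n ≠ 0 := fun n => norm_pos_iff.mp (by linarith [h1 n])
  obtain ⟨φ, hφ, g, hg⟩ := hf.normal (fun n => toSphere (rescale α β f (h n)))
    fun n => ⟨h n, h1 n, rfl⟩
  refine ⟨φ, hφ, g, ⟨?_, ?_, hg⟩, ?_⟩
  · exact fun n z => meromorphicNFAt_mul_comp_affine (cpow_ne_zero_of_ne_zero (h0 _) _) (hnf _)
  · intro n z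
    have := meromorphicOrderAt_mul_comp_affine (k := f) (h := h (φ n)) (z := z)
      (cpow_ne_zero_of_ne_zero (h0 (φ n)) (-(α : ℂ))) (cpow_ne_zero_of_ne_zero (h0 (φ n)) (-(β : ℂ)))
    unfold rescale
    rw [this]
    exact hf.order_ne_top _
  · refine hf.limit_nonconstant (fun n => h (φ n)) g ?_ hg
    refine tendsto_atTop_mono (fun n => ?_) tendsto_natCast_atTop_atTop
    have h2 : (n : ℝ) ≤ φ n := by exact_mod_cast hφ.id_le n
    have := hh (φ n)
    linarith

/-- Compactness: for all large `h`, on a disc about `h` whose radius is comparable with `‖h‖ ^ (-β)`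
either `f` or `1 / f` satisfies bounds of the order prescribed by the rescaling, uniformly in
`h`. -/
theorem GeneralisedYosida.exists_discBound (hf : GeneralisedYosida α β f)
    (hnf : ∀ z, MeromorphicNFAt f z) :
    ∃ ρ₀ M h₀ : ℝ, 0 < ρ₀ ∧ ρ₀ ≤ 1 ∧ 1 ≤ M ∧ 1 ≤ h₀ ∧ ∀ h : ℂ, h₀ ≤ ‖h‖ →
      ∃ ρ, ρ₀ ≤ ρ ∧ ρ ≤ 1 ∧ (DiscBound f (‖h‖ ^ α) h (ρ * ‖h‖ ^ (-β)) M ∨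
        DiscBound f⁻¹ (‖h‖ ^ (-α)) h (ρ * ‖h‖ ^ (-β)) M) := by
  by_contra hcon
  push Not at hcon
  have hseq : ∀ n : ℕ, ∃ h : ℂ, (n : ℝ) + 1 ≤ ‖h‖ ∧ ∀ ρ, ((n : ℝ) + 1)⁻¹ ≤ ρ → ρ ≤ 1 →
      ¬ DiscBound f (‖h‖ ^ α) h (ρ * ‖h‖ ^ (-β)) (n + 1) ∧
        ¬ DiscBound f⁻¹ (‖h‖ ^ (-α)) h (ρ * ‖h‖ ^ (-β)) (n + 1) := by
    intro n
    have hn : (0 : ℝ) ≤ n := n.cast_nonneg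
    exact hcon ((n : ℝ) + 1)⁻¹ (n + 1) (n + 1) (by positivity) (inv_le_one_of_one_le₀ (by linarith))
      (by linarith) (by linarith)
  choose h hh hbad using hseq
  obtain ⟨φ, hφ, g, hg, hgc⟩ := hf.exists_limit hnf hh
  have h0 : ∀ n, h n ≠ 0 := fun n => norm_pos_iff.mp (by
    have := hh n
    have : (0 : ℝ) ≤ n := n.cast_nonneg
    linarith)
  have hlarge : ∀ x : ℝ, ∀ᶠ n in atTop, x ≤ (φ n : ℝ) + 1 := by
    intro x
    filter_upwards [(tendsto_natCast_atTop_atTop (R := ℝ)).eventually_ge_atTop x] with n hn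
    have h2 : (n : ℝ) ≤ φ n := by exact_mod_cast hφ.id_le n
    linarith
  rcases exists_coe_norm_le_one (g 0) with ⟨u, hu, hu1⟩ | ⟨u, hu, hu1⟩
  · obtain ⟨ρ, M, hρ0, hρ1, hM, hev⟩ := hg.bounds_near_zero hgc hu hu1
    obtain ⟨n, hn, hn1, hn2⟩ := (hev.and ((hlarge ρ⁻¹).and (hlarge M))).exists
    have hh0 : 0 < ‖h (φ n)‖ := norm_pos_iff.mpr (h0 _)
    have h3 := DiscBound.of_affine (k := f) (h := h (φ n))
      (cpow_ne_zero_of_ne_zero (h0 (φ n)) (-(α : ℂ))) (cpow_ne_zero_of_ne_zero (h0 (φ n)) (-(β : ℂ))) hn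
    rw [norm_cpow_neg_ofReal (h0 _), norm_cpow_neg_ofReal (h0 _), Real.rpow_neg hh0.le,
      inv_inv] at h3
    exact (hbad (φ n) ρ (inv_le_of_inv_le₀ hρ0 hn1) hρ1).1
      (h3.mono (by positivity) (by linarith) hn2)
  · have hgc' : ¬ ∃ c : OnePoint ℂ, ∀ z, sphereInv (g z) = c := by
      rintro ⟨c, hc⟩
      exact hgc ⟨sphereInv c, fun z => by rw [← hc z, sphereInv_sphereInv]⟩
    obtain ⟨ρ, M, hρ0, hρ1, hM, hev⟩ := hg.inv.bounds_near_zero hgc' hu hu1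
    obtain ⟨n, hn, hn1, hn2⟩ := (hev.and ((hlarge ρ⁻¹).and (hlarge M))).exists
    have hh0 : 0 < ‖h (φ n)‖ := norm_pos_iff.mpr (h0 _)
    have heq : (rescale α β f (h (φ n)))⁻¹ = fun z => (h (φ n) ^ (-(α : ℂ)))⁻¹ *
        f⁻¹ (h (φ n) + h (φ n) ^ (-(β : ℂ)) * z) := by
      funext z
      simp [rescale, mul_comm]
    rw [heq] at hn
    have h3 := DiscBound.of_affine (k := f⁻¹) (h := h (φ n))
      (inv_ne_zero (cpow_ne_zero_of_ne_zero (h0 (φ n)) (-(α : ℂ))))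
      (cpow_ne_zero_of_ne_zero (h0 (φ n)) (-(β : ℂ))) hn
    rw [norm_inv, inv_inv, norm_cpow_neg_ofReal (h0 _), norm_cpow_neg_ofReal (h0 _)] at h3
    exact (hbad (φ n) ρ (inv_le_of_inv_le₀ hρ0 hn1) hρ1).2
      (h3.mono (by positivity) (by linarith) hn2)

end Yosida

namespace Yosida
open Filter Topology Metric Set

/-! ### Consequences of Jensen's formula -/

/-- The order of `f` at `u` as an integer: positive at zeros, negative at poles. -/
noncomputable def ord (f : ℂ → ℂ) (u : ℂ) : ℤ := (meromorphicOrderAt f u).untop₀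

/-- The zeros and poles of `f` in the closed disc about `c` of radius `R`. -/
noncomputable def zerosPoles (f : ℂ → ℂ) (c : ℂ) (R : ℝ) : Finset ℂ :=
  ((MeromorphicOn.divisor f (closedBall c R)).finiteSupport (isCompact_closedBall c R)).toFinset

variable {f : ℂ → ℂ}

theorem mem_zerosPoles (hm : Meromorphic f) {c u : ℂ} {R : ℝ} :
    u ∈ zerosPoles f c R ↔ ‖u - c‖ ≤ R ∧ ord f u ≠ 0 := by
  rw [zerosPoles, Set.Finite.mem_toFinset, Function.mem_support, MeromorphicOn.divisor_def,
    mem_closedBall, dist_eq_norm]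
  have : MeromorphicOn f (closedBall c R) := fun x _ => hm x
  simp only [this, true_and]
  split_ifs with h
  · simp [h, ord]
  · simp [h]

theorem ord_inv (f : ℂ → ℂ) (u : ℂ) : ord f⁻¹ u = -ord f u := by
  rw [ord, ord, meromorphicOrderAt_inv]
  cases meromorphicOrderAt f u <;> rfl

theorem ord_nonneg_of_analyticAt {u : ℂ} (h : AnalyticAt ℂ f u) : 0 ≤ ord f u := by
  rw [ord]
  exact WithTop.untop₀_nonneg.mpr h.meromorphicOrderAt_nonneg

theorem ord_eq_zero_of_ne_zero {u : ℂ} (h : AnalyticAt ℂ f u) (h0 : f u ≠ 0) : ord f u = 0 := by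
  rw [ord, h.meromorphicOrderAt_eq, h.analyticOrderAt_eq_zero.mpr h0]
  rfl

theorem circleIntegrable_log (hm : Meromorphic f) (c : ℂ) (R : ℝ) :
    CircleIntegrable (fun z => Real.log ‖f z‖) c R :=
  MeromorphicOn.circleIntegrable_log_norm fun x _ => hm x

/-- On a circle a meromorphic function is holomorphic and nonzero off a discrete set. -/
theorem eventually_ne_zero (hm : Meromorphic f) (ht : ∀ z, meromorphicOrderAt f z ≠ ⊤) (c : ℂ)
    (R : ℝ) : ∀ᶠ z in codiscreteWithin (sphere c R), AnalyticAt ℂ f z ∧ f z ≠ 0 := by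
  have hmo : MeromorphicOn f (sphere c R) := fun x _ => hm x
  filter_upwards [hmo.eventually_codiscreteWithin_apply_ne_zero fun x _ => ht x,
    hmo.analyticAt_mem_codiscreteWithin] with z h1 h2
  exact ⟨h2, h1⟩

/-- Circle averages are monotone for inequalities valid off a discrete set. -/
theorem circleAverage_le_of_codiscrete {f₁ f₂ : ℂ → ℝ} {c : ℂ} {R : ℝ} (hR : 0 < R)
    (h₁ : CircleIntegrable f₁ c R) (h₂ : CircleIntegrable f₂ c R)
    (h : ∀ᶠ z in codiscreteWithin (sphere c R), f₁ z ≤ f₂ z) :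
    Real.circleAverage f₁ c R ≤ Real.circleAverage f₂ c R := by
  have heq : f₁ =ᶠ[codiscreteWithin (sphere c |R|)] fun z => min (f₁ z) (f₂ z) := by
    rw [abs_of_pos hR]
    filter_upwards [h] with z hz
    rw [min_eq_left hz]
  rw [Real.circleAverage_congr_codiscreteWithin heq hR.ne']
  exact Real.circleAverage_mono (h₁.congr_codiscreteWithin heq) h₂ fun z _ => min_le_right _ _

/-- Jensen's formula, about a point that is neither a zero nor a pole. -/
theorem jensen (hm : Meromorphic f) {c : ℂ} {R : ℝ} (hR : 0 < R) (ha : AnalyticAt ℂ f c)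
    (h0 : f c ≠ 0) :
    Real.circleAverage (fun z => Real.log ‖f z‖) c R =
      ∑ u ∈ zerosPoles f c R, (ord f u : ℝ) * Real.log (R / ‖u - c‖) + Real.log ‖f c‖ := by
  have hmo : MeromorphicOn f (closedBall c R) := fun x _ => hm x
  have h := MeromorphicOn.circleAverage_log_norm (f := f) (c := c) hR.ne'
    (by rw [abs_of_pos hR]; exact hmo)
  rw [abs_of_pos hR, ha.meromorphicTrailingCoeffAt_of_ne_zero h0] at h
  rw [h]
  have hc : MeromorphicOn.divisor f (closedBall c R) c = 0 := by
    rw [MeromorphicOn.divisor_apply hmo (mem_closedBall_self hR.le)]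
    exact ord_eq_zero_of_ne_zero ha h0
  rw [hc, Int.cast_zero, zero_mul, add_zero, finsum_eq_sum_of_support_subset (s := zerosPoles f c R)]
  · congr 1
    refine Finset.sum_congr rfl fun u hu => ?_
    rw [MeromorphicOn.divisor_apply hmo, norm_sub_rev, ← div_eq_mul_inv]
    · rfl
    · rw [mem_closedBall, dist_eq_norm]
      exact ((mem_zerosPoles hm).mp hu).1
  · intro u hu
    have : MeromorphicOn.divisor f (closedBall c R) u ≠ 0 := by
      intro h0
      simp [h0] at hu
    simpa [zerosPoles] using this

theorem ne_of_mem_zerosPoles (hm : Meromorphic f) {c u : ℂ} {R : ℝ} (ha : AnalyticAt ℂ f c)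
    (h0 : f c ≠ 0) (hu : u ∈ zerosPoles f c R) : 0 < ‖u - c‖ := by
  rw [norm_pos_iff, sub_ne_zero]
  rintro rfl
  exact ((mem_zerosPoles hm).mp hu).2 (ord_eq_zero_of_ne_zero ha h0)

/-- The bounds on a disc control the number of zeros in a smaller disc, by Jensen's formula about a
point at which the function is not small. -/
theorem DiscBound.sum_ord_le {k : ℂ → ℂ} (hm : Meromorphic k)
    (ht : ∀ z, meromorphicOrderAt k z ≠ ⊤) {B r M : ℝ} {h : ℂ}
    (hk : DiscBound k B h r M) (hB : 0 < B) (hr : 0 < r) (hM : 1 ≤ M) {S : Finset ℂ}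
    (hS : ∀ u ∈ S, ‖u - h‖ ≤ r / 8) :
    ∑ u ∈ S, |(ord k u : ℝ)| ≤ 2 * Real.log M / Real.log 2 := by
  have hM0 : 0 < M := by linarith
  have hr4 : ‖((r / 4 : ℝ) : ℂ)‖ = r / 4 := by
    rw [Complex.norm_real, Real.norm_of_nonneg (by positivity)]
  -- the centre `c` keeps the discs of radii `3r/8` and `3r/4` about it inside the given discs
  set c : ℂ := h + ((r / 4 : ℝ) : ℂ) with hc
  have hch : ‖c - h‖ = r / 4 := by rw [hc, add_sub_cancel_left, hr4]
  have hsub : ∀ w, ‖w - c‖ ≤ 3 * r / 4 → w ∈ closedBall h r := by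
    intro w hw
    rw [mem_closedBall, dist_eq_norm]
    have := norm_add_le (w - c) (c - h)
    rw [sub_add_sub_cancel] at this
    linarith
  obtain ⟨hca, -, hcl⟩ := hk c (hsub c (by simp; positivity))
  have hcM := hcl (by rw [hch]; linarith)
  have hc0 : k c ≠ 0 := norm_pos_iff.mp (lt_of_lt_of_le (by positivity) hcM)
  have hR : (0 : ℝ) < 3 * r / 4 := by positivity
  have hj := jensen hm hR hca hc0
  have havg : Real.circleAverage (fun z => Real.log ‖k z‖) c (3 * r / 4) ≤ Real.log (M * B) := by
    rw [← Real.circleAverage_const (Real.log (M * B)) c (3 * r / 4)]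
    refine circleAverage_le_of_codiscrete hR (circleIntegrable_log hm c _)
      (circleIntegrable_const _ _ _) ?_
    filter_upwards [eventually_ne_zero hm ht c (3 * r / 4),
      self_mem_codiscreteWithin (sphere c (3 * r / 4))] with z hz0 hz
    rw [mem_sphere, dist_eq_norm] at hz
    exact Real.log_le_log (norm_pos_iff.mpr hz0.2) (hk z (hsub z hz.le)).2.1
  have hterm : ∀ u ∈ zerosPoles k c (3 * r / 4),
      0 ≤ (ord k u : ℝ) * Real.log (3 * r / 4 / ‖u - c‖) := by
    intro u hu
    have h1 := ((mem_zerosPoles hm).mp hu).1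
    have h2 := ord_nonneg_of_analyticAt (hk u (hsub u h1)).1
    refine mul_nonneg (by exact_mod_cast h2) (Real.log_nonneg ?_)
    rwa [one_le_div (ne_of_mem_zerosPoles hm hca hc0 hu)]
  have hlog2 : 0 < Real.log 2 := Real.log_pos (by norm_num)
  rw [le_div_iff₀ hlog2]
  classical
  have hSsub : S.filter (fun u => ord k u ≠ 0) ⊆ zerosPoles k c (3 * r / 4) := by
    intro u hu
    rw [Finset.mem_filter] at hu
    rw [mem_zerosPoles hm]
    refine ⟨?_, hu.2⟩
    have h1 := hS u hu.1
    have h2 := norm_sub_le (u - h) (c - h)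
    rw [sub_sub_sub_cancel_right] at h2
    linarith
  calc (∑ u ∈ S, |(ord k u : ℝ)|) * Real.log 2
      = ∑ u ∈ S.filter (fun u => ord k u ≠ 0), |(ord k u : ℝ)| * Real.log 2 := by
        rw [Finset.sum_mul, Finset.sum_filter]
        refine Finset.sum_congr rfl fun u _ => ?_
        split_ifs with h1
        · rfl
        · rw [not_not.mp h1]; simp
    _ ≤ ∑ u ∈ S.filter (fun u => ord k u ≠ 0),
          (ord k u : ℝ) * Real.log (3 * r / 4 / ‖u - c‖) := by
        refine Finset.sum_le_sum fun u hu => ?_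
        have h0 := ne_of_mem_zerosPoles hm hca hc0 (hSsub hu)
        have h1 := ((mem_zerosPoles hm).mp (hSsub hu)).1
        have h2 : (0 : ℝ) ≤ ord k u := by
          exact_mod_cast ord_nonneg_of_analyticAt (hk u (hsub u h1)).1
        rw [abs_of_nonneg h2]
        refine mul_le_mul_of_nonneg_left (Real.log_le_log (by norm_num) ?_) h2
        rw [le_div_iff₀ h0]
        have h3 := hS u (Finset.mem_filter.mp hu).1
        have h4 := norm_sub_le (u - h) (c - h)
        rw [sub_sub_sub_cancel_right] at h4
        linarith
    _ ≤ ∑ u ∈ zerosPoles k c (3 * r / 4), (ord k u : ℝ) * Real.log (3 * r / 4 / ‖u - c‖) :=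
        Finset.sum_le_sum_of_subset_of_nonneg hSsub fun u hu _ => hterm u hu
    _ ≤ Real.log (M * B) - Real.log (M⁻¹ * B) := by
        have := Real.log_le_log (by positivity) hcM
        linarith
    _ = 2 * Real.log M := by
        rw [Real.log_mul hM0.ne' hB.ne', Real.log_mul (by positivity) hB.ne', Real.log_inv]
        ring

/-- The bounds on a disc of radius `r` control the mean of `log ‖k‖` over its boundary circle. -/
theorem DiscBound.abs_circleAverage_sub_le {k : ℂ → ℂ} (hm : Meromorphic k) {B r M : ℝ} {h : ℂ}
    (hk : DiscBound k B h r M) (hB : 0 < B) (hr : 0 < r) (hM : 1 ≤ M) :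
    |Real.circleAverage (fun z => Real.log ‖k z‖) h r - Real.log B| ≤ Real.log M := by
  have hM0 : 0 < M := by linarith
  have hb : ∀ z ∈ sphere h |r|, |Real.log ‖k z‖ - Real.log B| ≤ Real.log M := by
    intro z hz
    rw [abs_of_pos hr, mem_sphere, dist_eq_norm] at hz
    obtain ⟨-, h2, h3⟩ := hk z (by rw [mem_closedBall, dist_eq_norm, hz])
    have h4 := h3 (by linarith)
    have h5 : 0 < M⁻¹ * B := by positivity
    have h6 := Real.log_le_log (h5.trans_le h4) h2
    have h7 := Real.log_le_log h5 h4
    rw [Real.log_mul hM0.ne' hB.ne'] at h6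
    rw [Real.log_mul (by positivity) hB.ne', Real.log_inv] at h7
    rw [abs_le]
    constructor <;> linarith
  have h1 : Real.circleAverage (fun z => Real.log ‖k z‖) h r - Real.log B =
      Real.circleAverage (fun z => Real.log ‖k z‖ - Real.log B) h r := by
    rw [Real.circleAverage_fun_sub (circleIntegrable_log hm _ _) (circleIntegrable_const _ _ _),
      Real.circleAverage_const]
  rw [h1]
  refine Real.abs_circleAverage_le_circleAverage_abs.trans ?_
  refine Real.circleAverage_mono_on_of_le_circle ?_ hb
  exact ((circleIntegrable_log hm _ _).sub (circleIntegrable_const _ _ _)).abs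

variable {α β : ℝ}

theorem GeneralisedYosida.order_inv_ne_top (hf : GeneralisedYosida α β f) (z : ℂ) :
    meromorphicOrderAt f⁻¹ z ≠ ⊤ := by
  rw [meromorphicOrderAt_inv]
  simpa using hf.order_ne_top z

/-- The number of zeros and poles in a disc about `h` of radius `ρ₁ * ‖h‖ ^ (-β)` is bounded. -/
theorem GeneralisedYosida.exists_sum_ord_le (hf : GeneralisedYosida α β f)
    (hnf : ∀ z, MeromorphicNFAt f z) :
    ∃ ρ₁ K h₀ : ℝ, 0 < ρ₁ ∧ ρ₁ ≤ 1 ∧ 0 < K ∧ 1 ≤ h₀ ∧ ∀ h : ℂ, h₀ ≤ ‖h‖ → ∀ S : Finset ℂ,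
      (∀ u ∈ S, ‖u - h‖ ≤ ρ₁ * ‖h‖ ^ (-β)) → ∑ u ∈ S, |(ord f u : ℝ)| ≤ K := by
  obtain ⟨ρ₀, M, h₀, hρ0, hρ1, hM, hh₀, H⟩ := hf.exists_discBound hnf
  have hlog2 : 0 < Real.log 2 := Real.log_pos (by norm_num)
  have hlogM : 0 ≤ Real.log M := Real.log_nonneg hM
  refine ⟨ρ₀ / 8, 2 * Real.log M / Real.log 2 + 1, h₀, by positivity, by linarith, by positivity,
    hh₀, fun h hh S hS => ?_⟩
  obtain ⟨ρ, hρ, -, hd⟩ := H h hh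
  have hh0 : 0 < ‖h‖ := by linarith
  have hδ : 0 < ‖h‖ ^ (-β) := by positivity
  have hr : 0 < ρ * ‖h‖ ^ (-β) := mul_pos (by linarith) hδ
  have hS' : ∀ u ∈ S, ‖u - h‖ ≤ ρ * ‖h‖ ^ (-β) / 8 := by
    intro u hu
    have h1 := hS u hu
    have h2 : ρ₀ * ‖h‖ ^ (-β) ≤ ρ * ‖h‖ ^ (-β) := by gcongr
    linarith
  rcases hd with hd | hd
  · have := hd.sum_ord_le hf.meromorphic hf.order_ne_top (by positivity) hr hM hS'
    linarith
  · have := hd.sum_ord_le hf.meromorphic.inv hf.order_inv_ne_top (by positivity) hr hM hS'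
    simp only [ord_inv, Int.cast_neg, abs_neg] at this
    linarith

/-- For all large `h`, the mean of `log ‖f‖` over some circle about `h` whose radius is comparable
with `‖h‖ ^ (-β)` differs from `α * log ‖h‖` by a bounded amount. -/
theorem GeneralisedYosida.exists_abs_circleAverage_sub_le (hf : GeneralisedYosida α β f)
    (hnf : ∀ z, MeromorphicNFAt f z) :
    ∃ C h₀ : ℝ, 0 ≤ C ∧ 1 ≤ h₀ ∧ ∀ h : ℂ, h₀ ≤ ‖h‖ → ∃ ρ, 0 < ρ ∧ ρ ≤ 1 ∧
      |Real.circleAverage (fun z => Real.log ‖f z‖) h (ρ * ‖h‖ ^ (-β)) - α * Real.log ‖h‖| ≤ C := by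
  obtain ⟨ρ₀, M, h₀, hρ0, hρ1, hM, hh₀, H⟩ := hf.exists_discBound hnf
  refine ⟨Real.log M, h₀, Real.log_nonneg hM, hh₀, fun h hh => ?_⟩
  obtain ⟨ρ, hρ, hρ', hd⟩ := H h hh
  have hh0 : 0 < ‖h‖ := by linarith
  have hδ : 0 < ‖h‖ ^ (-β) := by positivity
  have hr : 0 < ρ * ‖h‖ ^ (-β) := mul_pos (by linarith) hδ
  refine ⟨ρ, by linarith, hρ', ?_⟩
  rcases hd with hd | hd
  · have := hd.abs_circleAverage_sub_le hf.meromorphic (by positivity) hr hM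
    rwa [Real.log_rpow hh0] at this
  · have := hd.abs_circleAverage_sub_le hf.meromorphic.inv (by positivity) hr hM
    rw [Real.log_rpow hh0] at this
    have h1 : (fun z => Real.log ‖f⁻¹ z‖) = -fun z => Real.log ‖f z‖ := by
      funext z
      simp [Real.log_inv]
    have h2 : Real.circleAverage (-fun z => Real.log ‖f z‖) h (ρ * ‖h‖ ^ (-β)) =
        -Real.circleAverage (fun z => Real.log ‖f z‖) h (ρ * ‖h‖ ^ (-β)) := by
      have := Real.circleAverage_smul (a := (-1 : ℝ)) (f := fun z => Real.log ‖f z‖) (c := h)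
        (R := ρ * ‖h‖ ^ (-β))
      simpa using this
    rw [h1, h2, abs_sub_comm] at this
    convert this using 2
    ring

/-- Pointwise form of the estimate: `log ‖f h‖` differs from `α * log ‖h‖` by a bounded amount and
the contribution of the zeros and poles at distance less than `‖h‖ ^ (-β)`. -/
theorem GeneralisedYosida.exists_abs_log_sub_le (hf : GeneralisedYosida α β f)
    (hnf : ∀ z, MeromorphicNFAt f z) :
    ∃ C h₀ : ℝ, 0 ≤ C ∧ 1 ≤ h₀ ∧ ∀ h : ℂ, h₀ ≤ ‖h‖ → AnalyticAt ℂ f h → f h ≠ 0 →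
      |Real.log ‖f h‖ - α * Real.log ‖h‖| ≤ C + ∑ u ∈ zerosPoles f h (‖h‖ ^ (-β)),
        |(ord f u : ℝ)| * Real.log (‖h‖ ^ (-β) / ‖u - h‖) := by
  obtain ⟨C, h₀, hC, hh₀, H⟩ := hf.exists_abs_circleAverage_sub_le hnf
  refine ⟨C, h₀, hC, hh₀, fun h hh ha h0 => ?_⟩
  obtain ⟨ρ, hρ0, hρ1, hav⟩ := H h hh
  have hh0 : 0 < ‖h‖ := by linarith
  have hδ : 0 < ‖h‖ ^ (-β) := by positivity
  set δ := ‖h‖ ^ (-β) with hδd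
  have hr : 0 < ρ * δ := mul_pos hρ0 hδ
  have hrδ : ρ * δ ≤ δ := by nlinarith
  have hj := jensen hf.meromorphic hr ha h0
  have hsub : zerosPoles f h (ρ * δ) ⊆ zerosPoles f h δ := by
    intro u hu
    rw [mem_zerosPoles hf.meromorphic] at hu ⊢
    exact ⟨hu.1.trans hrδ, hu.2⟩
  have hsum : |∑ u ∈ zerosPoles f h (ρ * δ), (ord f u : ℝ) * Real.log (ρ * δ / ‖u - h‖)| ≤
      ∑ u ∈ zerosPoles f h δ, |(ord f u : ℝ)| * Real.log (δ / ‖u - h‖) := by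
    refine (Finset.abs_sum_le_sum_abs _ _).trans ?_
    refine (Finset.sum_le_sum fun u hu => ?_).trans
      (Finset.sum_le_sum_of_subset_of_nonneg hsub fun u hu _ => ?_)
    · have hpos := ne_of_mem_zerosPoles hf.meromorphic ha h0 hu
      have h1 := ((mem_zerosPoles hf.meromorphic).mp hu).1
      rw [abs_mul, abs_of_nonneg (Real.log_nonneg ((one_le_div hpos).mpr h1))]
      gcongr
    · have hpos := ne_of_mem_zerosPoles hf.meromorphic ha h0 hu
      have h1 := ((mem_zerosPoles hf.meromorphic).mp hu).1
      exact mul_nonneg (abs_nonneg _) (Real.log_nonneg ((one_le_div hpos).mpr h1))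
  rw [abs_le] at hav hsum ⊢
  constructor <;> linarith [hav.1, hav.2, hsum.1, hsum.2]

/-- Away from the poles, `f` is bounded by a multiple of `‖h‖ ^ α`. -/
theorem GeneralisedYosida.exists_norm_le_of_no_poles (hf : GeneralisedYosida α β f)
    (hnf : ∀ z, MeromorphicNFAt f z) :
    ∃ M h₀ : ℝ, 0 ≤ M ∧ 1 ≤ h₀ ∧ ∀ h : ℂ, h₀ ≤ ‖h‖ →
      (∀ u ∈ closedBall h (‖h‖ ^ (-β)), AnalyticAt ℂ f u) → ‖f h‖ ≤ M * ‖h‖ ^ α := by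
  obtain ⟨C, h₀, hC, hh₀, H⟩ := hf.exists_abs_circleAverage_sub_le hnf
  refine ⟨Real.exp C, h₀, (Real.exp_pos C).le, hh₀, fun h hh hna => ?_⟩
  obtain ⟨ρ, hρ0, hρ1, hav⟩ := H h hh
  have hh0 : 0 < ‖h‖ := by linarith
  have hδ : 0 < ‖h‖ ^ (-β) := by positivity
  by_cases h0 : f h = 0
  · rw [h0, norm_zero]; positivity
  have ha := hna h (mem_closedBall_self hδ.le)
  have hr : 0 < ρ * ‖h‖ ^ (-β) := mul_pos hρ0 hδ
  have hj := jensen hf.meromorphic hr ha h0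
  have hsum : 0 ≤ ∑ u ∈ zerosPoles f h (ρ * ‖h‖ ^ (-β)),
      (ord f u : ℝ) * Real.log (ρ * ‖h‖ ^ (-β) / ‖u - h‖) := by
    refine Finset.sum_nonneg fun u hu => ?_
    have hpos := ne_of_mem_zerosPoles hf.meromorphic ha h0 hu
    have h1 := ((mem_zerosPoles hf.meromorphic).mp hu).1
    refine mul_nonneg ?_ (Real.log_nonneg ((one_le_div hpos).mpr h1))
    have h2 : u ∈ closedBall h (‖h‖ ^ (-β)) := by
      rw [mem_closedBall, dist_eq_norm]
      nlinarith
    exact_mod_cast ord_nonneg_of_analyticAt (hna u h2)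
  have h2 : Real.log ‖f h‖ ≤ C + α * Real.log ‖h‖ := by
    linarith [(abs_le.mp hav).2]
  rw [← Real.log_le_log_iff (norm_pos_iff.mpr h0) (by positivity),
    Real.log_mul (Real.exp_pos C).ne' (by positivity), Real.log_exp, Real.log_rpow hh0]
  exact h2

end Yosida

namespace Yosida
open Filter Topology Metric Set

/-! ### Distribution of zeros and poles -/

theorem rpow_le_two_rpow_abs_mul {x y : ℝ} (a : ℝ) (hx : 0 < x) (h1 : x / 2 ≤ y) (h2 : y ≤ 2 * x) :
    y ^ a ≤ 2 ^ |a| * x ^ a := by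
  have hy : 0 < y := by linarith
  rcases le_total 0 a with ha | ha
  · rw [abs_of_nonneg ha, ← Real.mul_rpow (by norm_num) hx.le]
    exact Real.rpow_le_rpow hy.le h2 ha
  · rw [abs_of_nonpos ha]
    have h3 : (2 : ℝ) ^ (-a) * x ^ a = (x / 2) ^ a := by
      rw [Real.div_rpow hx.le (by norm_num), Real.rpow_neg (by norm_num)]
      field_simp
    rw [h3]
    exact Real.rpow_le_rpow_of_nonpos (by positivity) h1 ha

variable {f : ℂ → ℂ} {α β : ℝ}

/-- Every disc about a large `h` of radius `R * ‖h‖ ^ (-β)`, with a suitable constant `R`, contains a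
pole: otherwise some limit function would be entire and bounded. -/
theorem GeneralisedYosida.exists_pole_near (hβ : -1 < β) (hf : GeneralisedYosida α β f)
    (hnf : ∀ z, MeromorphicNFAt f z) :
    ∃ R h₀ : ℝ, 0 < R ∧ 1 ≤ h₀ ∧ ∀ h : ℂ, h₀ ≤ ‖h‖ →
      ∃ w, ‖w - h‖ ≤ R * ‖h‖ ^ (-β) ∧ ord f w < 0 := by
  by_contra hcon
  push Not at hcon
  have hseq : ∀ n : ℕ, ∃ h : ℂ, (n : ℝ) + 1 ≤ ‖h‖ ∧ ∀ w, ‖w - h‖ ≤ (n + 1) * ‖h‖ ^ (-β) →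
      AnalyticAt ℂ f w := by
    intro n
    have hn : (0 : ℝ) ≤ n := n.cast_nonneg
    obtain ⟨h, hh, H⟩ := hcon (n + 1) (n + 1) (by linarith) (by linarith)
    refine ⟨h, hh, fun w hw => ?_⟩
    rw [← (hnf w).meromorphicOrderAt_nonneg_iff_analyticAt]
    have h1 := H w hw
    rw [ord] at h1
    exact WithTop.untop₀_nonneg.mp h1
  choose h hh han using hseq
  obtain ⟨φ, hφ, g, hg, hgc⟩ := hf.exists_limit hnf hh
  have hlarge : ∀ x : ℝ, ∀ᶠ n in atTop, x ≤ (φ n : ℝ) + 1 := by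
    intro x
    filter_upwards [(tendsto_natCast_atTop_atTop (R := ℝ)).eventually_ge_atTop x] with n hn
    have h2 : (n : ℝ) ≤ φ n := by exact_mod_cast hφ.id_le n
    linarith
  have hnorm : Tendsto (fun n => ‖h (φ n)‖) atTop atTop := by
    rw [Filter.tendsto_atTop]
    intro x
    filter_upwards [hlarge x] with n hn
    exact hn.trans (hh _)
  obtain ⟨M, h₀, hM, hh₀, H⟩ := hf.exists_norm_le_of_no_poles hnf
  have hbd : ∀ s : ℝ, 0 < s → ∀ᶠ n in atTop, ∀ z ∈ ball (0 : ℂ) s,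
      AnalyticAt ℂ (rescale α β f (h (φ n))) z ∧
        ‖rescale α β f (h (φ n)) z‖ ≤ M * 2 ^ |α| := by
    intro s hs
    have hsmall : ∀ᶠ n in atTop, ‖h (φ n)‖ ^ (-(1 + β)) ≤ (2 * s)⁻¹ :=
      ((tendsto_rpow_neg_atTop (by linarith : 0 < 1 + β)).comp hnorm).eventually_le_const
        (by positivity)
    filter_upwards [hsmall, hnorm.eventually_ge_atTop (2 * h₀),
      hlarge (s + 2 ^ |(-β)|)] with n hn1 hn2 hn3 z hz
    set a := h (φ n) with ha
    have ha0 : 0 < ‖a‖ := by linarith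
    have hane : a ≠ 0 := norm_pos_iff.mp ha0
    have hδ : 0 < ‖a‖ ^ (-β) := by positivity
    rw [mem_ball_zero_iff] at hz
    set w := a + a ^ (-(β : ℂ)) * z with hw
    have hwa : ‖w - a‖ ≤ s * ‖a‖ ^ (-β) := by
      rw [hw, add_sub_cancel_left, norm_mul, norm_cpow_neg_ofReal hane, mul_comm]
      gcongr
    have hsa : s * ‖a‖ ^ (-β) ≤ ‖a‖ / 2 := by
      have h1 : ‖a‖ ^ (-β) = ‖a‖ ^ (-(1 + β)) * ‖a‖ := by
        rw [← Real.rpow_add_one ha0.ne']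
        congr 1
        ring
      rw [h1]
      calc s * (‖a‖ ^ (-(1 + β)) * ‖a‖) ≤ s * ((2 * s)⁻¹ * ‖a‖) := by gcongr
        _ = ‖a‖ / 2 := by field_simp
    have hw1 : ‖a‖ / 2 ≤ ‖w‖ := by
      have := norm_sub_norm_le a w
      rw [norm_sub_rev] at this
      linarith
    have hw2 : ‖w‖ ≤ 2 * ‖a‖ := by
      have := norm_sub_norm_le w a
      linarith
    have hball : ∀ u ∈ closedBall w (‖w‖ ^ (-β)), AnalyticAt ℂ f u := by
      intro u hu
      apply han (φ n) u
      rw [mem_closedBall, dist_eq_norm] at hu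
      have h1 := rpow_le_two_rpow_abs_mul (-β) ha0 hw1 hw2
      have h2 := norm_add_le (u - w) (w - a)
      rw [sub_add_sub_cancel] at h2
      calc ‖u - a‖ ≤ (s + 2 ^ |(-β)|) * ‖a‖ ^ (-β) := by linarith
        _ ≤ _ := by gcongr
    have hwan : AnalyticAt ℂ f w := hball w (mem_closedBall_self (by positivity))
    refine ⟨?_, ?_⟩
    · have h1 : AnalyticAt ℂ (f ∘ fun z => a + a ^ (-(β : ℂ)) * z) z :=
        AnalyticAt.comp (g := f) hwan (analyticAt_add_mul _ _ _)
      exact analyticAt_const.mul h1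
    · have h1 := H w (by linarith) hball
      have h2 := rpow_le_two_rpow_abs_mul α ha0 hw1 hw2
      rw [rescale, norm_mul, norm_cpow_neg_ofReal hane, Real.rpow_neg ha0.le, ← hw,
        inv_mul_le_iff₀ (by positivity)]
      calc ‖f w‖ ≤ M * ‖w‖ ^ α := h1
        _ ≤ M * (2 ^ |α| * ‖a‖ ^ α) := by gcongr
        _ = _ := by ring
  have hloc : ∀ s : ℝ, 0 < s → ∃ G : ℂ → ℂ, DifferentiableOn ℂ G (ball 0 s) ∧
      (∀ z ∈ ball (0 : ℂ) s, g z = G z) ∧ ∀ z ∈ ball (0 : ℂ) s, ‖G z‖ ≤ M * 2 ^ |α| := by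
    intro s hs
    obtain ⟨G, h1, h2, h3, -⟩ := hg.analytic_limit isOpen_ball (hbd s hs)
    exact ⟨G, h1, h2, h3⟩
  have hfin : ∀ z, ∃ u : ℂ, g z = u ∧ ‖u‖ ≤ M * 2 ^ |α| := by
    intro z
    obtain ⟨G, -, h2, h3⟩ := hloc (‖z‖ + 1) (by positivity)
    have hz : z ∈ ball (0 : ℂ) (‖z‖ + 1) := by simp
    exact ⟨G z, h2 z hz, h3 z hz⟩
  choose G hG hGb using hfin
  have hdiff : Differentiable ℂ G := by
    intro z
    obtain ⟨G', h1, h2, -⟩ := hloc (‖z‖ + 1) (by positivity)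
    have hz : z ∈ ball (0 : ℂ) (‖z‖ + 1) := by simp
    refine (h1.differentiableAt (isOpen_ball.mem_nhds hz)).congr_of_eventuallyEq ?_
    filter_upwards [isOpen_ball.mem_nhds hz] with y hy
    exact OnePoint.coe_injective ((hG y).symm.trans (h2 y hy))
  have hbounded : Bornology.IsBounded (range G) := by
    rw [isBounded_iff_forall_norm_le]
    exact ⟨M * 2 ^ |α|, by rintro _ ⟨z, rfl⟩; exact hGb z⟩
  exact hgc ⟨G 0, fun z => by rw [hG z, hdiff.apply_eq_apply_of_bounded hbounded z 0]⟩

theorem norm_sub_le_of_polar (u v : ℂ) :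
    ‖u - v‖ ≤ |‖u‖ - ‖v‖| + ‖v‖ * |u.arg - v.arg| := by
  have h1 : u - v = ((‖u‖ - ‖v‖ : ℝ) : ℂ) * Complex.exp (u.arg * Complex.I) +
      ‖v‖ * Complex.exp (v.arg * Complex.I) *
        (Complex.exp (Complex.I * ((u.arg - v.arg : ℝ) : ℂ)) - 1) := by
    have h2 : Complex.exp (v.arg * Complex.I) *
        Complex.exp (Complex.I * ((u.arg - v.arg : ℝ) : ℂ)) = Complex.exp (u.arg * Complex.I) := by
      rw [← Complex.exp_add]
      congr 1
      push_cast
      ring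
    calc u - v = ‖u‖ * Complex.exp (u.arg * Complex.I) - ‖v‖ * Complex.exp (v.arg * Complex.I) := by
          rw [Complex.norm_mul_exp_arg_mul_I, Complex.norm_mul_exp_arg_mul_I]
      _ = _ := by
          rw [mul_sub, mul_assoc, h2]
          push_cast
          ring
  rw [h1]
  refine (norm_add_le _ _).trans ?_
  rw [norm_mul, norm_mul, norm_mul, Complex.norm_exp_ofReal_mul_I, Complex.norm_exp_ofReal_mul_I,
    Complex.norm_real, Complex.norm_real, Real.norm_eq_abs, mul_one, mul_one, norm_norm]
  gcongr
  exact Real.norm_exp_I_mul_ofReal_sub_one_le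

theorem card_Icc_floor_le (a b : ℝ) (hab : a ≤ b) :
    ((Finset.Icc ⌊a⌋ ⌊b⌋).card : ℝ) ≤ b - a + 2 := by
  rw [Int.card_Icc]
  have h1 : ⌊a⌋ ≤ ⌊b⌋ := Int.floor_le_floor hab
  have h2 : (((⌊b⌋ + 1 - ⌊a⌋).toNat : ℤ) : ℝ) = (⌊b⌋ : ℝ) + 1 - ⌊a⌋ := by
    rw [Int.toNat_of_nonneg (by omega)]
    push_cast
    ring
  have h3 := Int.floor_le b
  have h4 := Int.lt_floor_add_one a
  have h5 : ((⌊b⌋ + 1 - ⌊a⌋).toNat : ℝ) = (⌊b⌋ : ℝ) + 1 - ⌊a⌋ := by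
    rw [← h2]
    norm_cast
  rw [h5]
  linarith

/-- The number of zeros and poles in an annulus is bounded by the number of polar cells of diameter
comparable with `r ^ (-β)` that are needed to cover it. -/
theorem GeneralisedYosida.exists_sum_ord_annulus_le (hβ : -1 < β) (hf : GeneralisedYosida α β f)
    (hnf : ∀ z, MeromorphicNFAt f z) :
    ∃ K r₀ : ℝ, 0 < K ∧ 1 ≤ r₀ ∧ ∀ r r₁ r₂ : ℝ, r₀ ≤ r → r / 2 ≤ r₁ → r₁ ≤ r₂ → r₂ ≤ 2 * r →
      ∀ S : Finset ℂ, (∀ u ∈ S, r₁ ≤ ‖u‖ ∧ ‖u‖ ≤ r₂) →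
        ∑ u ∈ S, |(ord f u : ℝ)| ≤ K * ((r₂ - r₁) * r ^ β + 1) * r ^ (β + 1) := by
  classical
  obtain ⟨ρ, K, h₀, hρ0, hρ1, hK, hh₀, H⟩ := hf.exists_sum_ord_le hnf
  have h2β : (1 : ℝ) ≤ 2 ^ |(-β)| := Real.one_le_rpow (by norm_num) (abs_nonneg _)
  set c : ℝ := ρ / (3 * 2 ^ |(-β)|) with hc
  have hc0 : 0 < c := by positivity
  have hc1 : c ≤ 1 := by
    rw [hc, div_le_one (by positivity)]
    linarith
  have hπ := Real.pi_pos
  refine ⟨K * (2 / c) * (2 * Real.pi / c + 2), 2 * h₀, by positivity, by linarith,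
    fun r r₁ r₂ hr hr1 hr12 hr2 S hS => ?_⟩
  have hr0 : 0 < r := by linarith
  set η : ℝ := c * r ^ (-β) with hη
  have hη0 : 0 < η := by positivity
  have hηi : η⁻¹ = r ^ β / c := by
    rw [hη, Real.rpow_neg hr0.le]
    field_simp
  set I := Finset.Icc ⌊r₁ / η⌋ ⌊r₂ / η⌋ with hI
  set J := Finset.Icc ⌊-(r * Real.pi / η)⌋ ⌊r * Real.pi / η⌋ with hJ
  let cell : ℂ → ℤ × ℤ := fun u => (⌊‖u‖ / η⌋, ⌊r * u.arg / η⌋)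
  have hmaps : ∀ u ∈ S, cell u ∈ I ×ˢ J := by
    intro u hu
    obtain ⟨h1, h2⟩ := hS u hu
    have h3 := Complex.arg_le_pi u
    have h4 := Complex.neg_pi_lt_arg u
    rw [Finset.mem_product, Finset.mem_Icc, Finset.mem_Icc]
    refine ⟨⟨Int.floor_le_floor ?_, Int.floor_le_floor ?_⟩,
      Int.floor_le_floor ?_, Int.floor_le_floor ?_⟩
    · gcongr
    · gcongr
    · rw [← neg_div, div_le_div_iff_of_pos_right hη0]
      nlinarith
    · gcongr
  have hfloor : ∀ x y : ℝ, ⌊x⌋ = ⌊y⌋ → |x - y| ≤ 1 := fun x y hxy =>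
    (Int.abs_sub_lt_one_of_floor_eq_floor hxy).le
  have hfib : ∀ p ∈ I ×ˢ J, ∑ u ∈ S with cell u = p, |(ord f u : ℝ)| ≤ K := by
    intro p _
    rcases (S.filter fun u => cell u = p).eq_empty_or_nonempty with he | ⟨v, hv⟩
    · rw [he, Finset.sum_empty]
      exact hK.le
    rw [Finset.mem_filter] at hv
    obtain ⟨hvS, hvp⟩ := hv
    obtain ⟨hv1, hv2⟩ := hS v hvS
    have hv0 : 0 < ‖v‖ := by linarith
    refine H v (by linarith) _ fun u hu => ?_
    rw [Finset.mem_filter] at hu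
    have hcell : cell u = cell v := hu.2.trans hvp.symm
    have e1 := hfloor _ _ (congrArg Prod.fst hcell)
    have e2 := hfloor _ _ (congrArg Prod.snd hcell)
    rw [← sub_div, abs_div, abs_of_pos hη0, div_le_one hη0] at e1 e2
    rw [← mul_sub, abs_mul, abs_of_pos hr0] at e2
    have h5 : r ^ (-β) ≤ 2 ^ |(-β)| * ‖v‖ ^ (-β) :=
      rpow_le_two_rpow_abs_mul (-β) hv0 (by linarith) (by linarith)
    calc ‖u - v‖ ≤ |‖u‖ - ‖v‖| + ‖v‖ * |u.arg - v.arg| := norm_sub_le_of_polar u v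
      _ ≤ η + 2 * r * |u.arg - v.arg| := by
          gcongr
          linarith
      _ ≤ 3 * c * r ^ (-β) := by rw [mul_assoc 3, ← hη]; linarith
      _ ≤ 3 * c * (2 ^ |(-β)| * ‖v‖ ^ (-β)) := by gcongr
      _ = ρ * ‖v‖ ^ (-β) := by
          rw [hc]
          field_simp
  have hrβ : 0 < r ^ β := by positivity
  have hrβ1 : 1 ≤ r ^ (β + 1) := Real.one_le_rpow (by linarith) (by linarith)
  have hIc : (I.card : ℝ) ≤ 2 / c * ((r₂ - r₁) * r ^ β + 1) := by
    refine (card_Icc_floor_le _ _ (by gcongr)).trans ?_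
    rw [← sub_div, div_eq_mul_inv (r₂ - r₁), hηi]
    have h1 : 0 ≤ (r₂ - r₁) * r ^ β / c := by
      have : 0 ≤ r₂ - r₁ := by linarith
      positivity
    have h2 : 2 ≤ 2 / c := by rw [le_div_iff₀ hc0]; linarith
    calc (r₂ - r₁) * (r ^ β / c) + 2 ≤ 2 * ((r₂ - r₁) * r ^ β / c) + 2 / c := by
          rw [← mul_div_assoc]; linarith
      _ = _ := by ring
  have hJc : (J.card : ℝ) ≤ (2 * Real.pi / c + 2) * r ^ (β + 1) := by
    refine (card_Icc_floor_le _ _ ?_).trans ?_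
    · have : 0 ≤ r * Real.pi / η := by positivity
      linarith
    rw [div_eq_mul_inv, hηi, Real.rpow_add_one hr0.ne']
    rw [Real.rpow_add_one hr0.ne'] at hrβ1
    calc r * Real.pi * (r ^ β / c) - -(r * Real.pi * (r ^ β / c)) + 2
        ≤ r * Real.pi * (r ^ β / c) - -(r * Real.pi * (r ^ β / c)) + 2 * (r ^ β * r) := by linarith
      _ = _ := by ring
  calc ∑ u ∈ S, |(ord f u : ℝ)|
      = ∑ p ∈ I ×ˢ J, ∑ u ∈ S with cell u = p, |(ord f u : ℝ)| :=
        (Finset.sum_fiberwise_of_maps_to hmaps _).symm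
    _ ≤ ∑ p ∈ I ×ˢ J, K := Finset.sum_le_sum hfib
    _ = I.card * J.card * K := by
        rw [Finset.sum_const, Finset.card_product, nsmul_eq_mul]
        push_cast
        ring
    _ ≤ (2 / c * ((r₂ - r₁) * r ^ β + 1)) * ((2 * Real.pi / c + 2) * r ^ (β + 1)) * K := by
        gcongr
    _ = _ := by ring

end Yosida

namespace Yosida
open Filter Topology Metric Set

/-! ### The mean of `|log ‖f‖|` over large circles -/

/-- A function on the circle of radius `r` that is nonnegative, dominates `log (δ / ‖z - u‖)` and has
mean `O(δ / r)`. On the circle `‖z - u‖ ^ 2 + δ ^ 2` is a constant multiple of `‖z - b‖ ^ 2` for a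
point `b` of the closed disc, so the mean of half the logarithm of `1 + δ ^ 2 / ‖z - u‖ ^ 2` is
explicit. -/
theorem exists_log_kernel {r δ : ℝ} (hδ : 0 < δ) (hδr : δ ≤ r) {u : ℂ} (hu : ‖u‖ ≤ r + δ) :
    ∃ Φ : ℂ → ℝ, CircleIntegrable Φ 0 r ∧
      (∀ z, ‖z‖ = r → z ≠ u → 0 ≤ Φ z ∧ Real.log (δ / ‖u - z‖) ≤ Φ z) ∧
      Real.circleAverage Φ 0 r ≤ 3 * (δ / r) := by
  have hr : 0 < r := by linarith
  set a := ‖u‖ with ha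
  have ha0 : 0 ≤ a := norm_nonneg u
  set A := r ^ 2 + a ^ 2 + δ ^ 2 with hA
  set D := ((r - a) ^ 2 + δ ^ 2) * ((r + a) ^ 2 + δ ^ 2) with hD
  have hD0 : 0 ≤ D := by positivity
  have hsq : Real.sqrt D ^ 2 = D := Real.sq_sqrt hD0
  have hA0 : 0 < A := by positivity
  set κ := (A + Real.sqrt D) / (2 * r ^ 2) with hκ
  have hκ0 : 0 < κ := by positivity
  have hκA : 2 * r ^ 2 * κ = A + Real.sqrt D := by
    rw [hκ]
    field_simp
  have hquad : r ^ 2 * κ ^ 2 + a ^ 2 = A * κ := by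
    have h1 : (2 * r ^ 2 * κ - A) ^ 2 = D := by rw [hκA, add_sub_cancel_left, hsq]
    have h2 : 4 * r ^ 2 * (r ^ 2 * κ ^ 2 + a ^ 2 - A * κ) = 0 := by
      rw [hD] at h1
      rw [hA] at h1 ⊢
      linear_combination h1
    have h3 : r ^ 2 * κ ^ 2 + a ^ 2 - A * κ = 0 := by
      rcases mul_eq_zero.mp h2 with h | h
      · exact absurd h (by positivity)
      · exact h
    linarith
  have hsqrt : Real.sqrt D ≤ (|r - a| + δ) * (r + a + δ) := by
    rw [Real.sqrt_le_left (by positivity), hD, mul_pow]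
    gcongr
    · rw [← sq_abs (r - a)]
      nlinarith [abs_nonneg (r - a)]
    · nlinarith
  have hκ1 : κ ≤ 1 + 6 * (δ / r) := by
    have h1 : 2 * r ^ 2 * κ ≤ 2 * r ^ 2 * (1 + 6 * (δ / r)) := by
      have h2 : 2 * r ^ 2 * (1 + 6 * (δ / r)) = 2 * r ^ 2 + 12 * r * δ := by
        field_simp
        ring
      rw [h2, hκA]
      rcases le_total a r with h | h
      · rw [abs_of_nonneg (by linarith)] at hsqrt
        nlinarith
      · rw [abs_of_nonpos (by linarith)] at hsqrt
        nlinarith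
    exact le_of_mul_le_mul_left h1 (by positivity)
  set b : ℂ := u / κ with hb
  have hbn : ‖b‖ ≤ r := by
    rw [hb, norm_div, Complex.norm_real, Real.norm_of_nonneg hκ0.le, div_le_iff₀ hκ0, ← ha]
    have h1 := Real.sqrt_nonneg D
    have h2 : 2 * r * a ≤ 2 * r ^ 2 * κ := by
      rw [hκA]
      nlinarith [sq_nonneg (r - a), sq_nonneg δ]
    have h3 : 2 * r * a ≤ 2 * r * (r * κ) := by linarith
    exact le_of_mul_le_mul_left h3 (by positivity)
  have hid : ∀ z : ℂ, ‖z‖ = r → κ * ‖z - b‖ ^ 2 = ‖z - u‖ ^ 2 + δ ^ 2 := by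
    intro z hz
    have h1 : κ * ‖z - b‖ ^ 2 = κ⁻¹ * ‖(κ : ℂ) * z - u‖ ^ 2 := by
      have : (κ : ℂ) * z - u = κ * (z - b) := by
        rw [hb, mul_sub, mul_div_cancel₀ _ (by exact_mod_cast hκ0.ne')]
      rw [this, norm_mul, Complex.norm_real, Real.norm_of_nonneg hκ0.le]
      field_simp
    have h2 : ‖(κ : ℂ) * z - u‖ ^ 2 = κ ^ 2 * r ^ 2 - κ * (2 * (z.re * u.re + z.im * u.im)) + a ^ 2 := by
      rw [← hz, ha, Complex.sq_norm, Complex.sq_norm, Complex.sq_norm, Complex.normSq_apply,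
        Complex.normSq_apply, Complex.normSq_apply]
      simp
      ring
    have h3 : ‖z - u‖ ^ 2 = r ^ 2 - 2 * (z.re * u.re + z.im * u.im) + a ^ 2 := by
      rw [← hz, ha, Complex.sq_norm, Complex.sq_norm, Complex.sq_norm, Complex.normSq_apply,
        Complex.normSq_apply, Complex.normSq_apply]
      simp
      ring
    rw [h1, h2, h3, inv_mul_eq_iff_eq_mul₀ hκ0.ne']
    linear_combination hquad
  have hint : ∀ v : ℂ, CircleIntegrable (fun z => Real.log ‖z - v‖) 0 r := fun v =>
    circleIntegrable_log (f := fun z => z - v) (fun z => by fun_prop) 0 r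
  refine ⟨fun z => (1 / 2 * Real.log κ + Real.log ‖z - b‖) - Real.log ‖z - u‖, ?_, ?_, ?_⟩
  · exact ((circleIntegrable_const _ _ _).add (hint b)).sub (hint u)
  · intro z hz hzu
    have hzu0 : 0 < ‖z - u‖ := norm_pos_iff.mpr (sub_ne_zero.mpr hzu)
    have h1 := hid z hz
    have hzb0 : 0 < ‖z - b‖ := by
      rw [norm_pos_iff]
      intro h0
      rw [h0, norm_zero] at h1
      nlinarith
    have h2 : Real.log (‖z - u‖ ^ 2 + δ ^ 2) = Real.log κ + 2 * Real.log ‖z - b‖ := by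
      rw [← h1, Real.log_mul hκ0.ne' (by positivity), Real.log_pow]
      norm_num
    have h3 : 2 * Real.log ‖z - u‖ ≤ Real.log (‖z - u‖ ^ 2 + δ ^ 2) := by
      have : Real.log (‖z - u‖ ^ 2) = 2 * Real.log ‖z - u‖ := by simp
      rw [← this]
      exact Real.log_le_log (by positivity) (by nlinarith)
    have h4 : 2 * Real.log δ ≤ Real.log (‖z - u‖ ^ 2 + δ ^ 2) := by
      have : Real.log (δ ^ 2) = 2 * Real.log δ := by simp
      rw [← this]
      exact Real.log_le_log (by positivity) (by nlinarith)
    rw [norm_sub_rev u z, Real.log_div hδ.ne' hzu0.ne']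
    constructor <;> linarith
  · have hcb : CircleIntegrable (fun z => 1 / 2 * Real.log κ + Real.log ‖z - b‖) 0 r :=
      (circleIntegrable_const _ _ _).add (hint b)
    rw [Real.circleAverage_fun_sub hcb (hint u),
      Real.circleAverage_fun_add (circleIntegrable_const _ _ _) (hint b),
      Real.circleAverage_const, circleAverage_log_norm_sub_const_of_mem_closedBall (by
        rwa [abs_of_pos hr, mem_closedBall_zero_iff]),
      circleAverage_log_norm_sub_const_eq_log_radius_add_posLog hr.ne']
    have h1 := Real.posLog_nonneg (x := r⁻¹ * ‖0 - u‖)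
    have h2 : Real.log κ ≤ 6 * (δ / r) := by
      have := Real.log_le_sub_one_of_pos hκ0
      linarith
    linarith

variable {f : ℂ → ℂ} {α β : ℝ}

/-- The mean of `|log ‖f‖|` over the circle of radius `r` is `O(log r)`. -/
theorem GeneralisedYosida.exists_circleAverage_abs_log_le (hβ : -1 < β)
    (hf : GeneralisedYosida α β f) (hnf : ∀ z, MeromorphicNFAt f z) :
    ∃ C r₀ : ℝ, 1 ≤ r₀ ∧ ∀ r, r₀ ≤ r →
      Real.circleAverage (fun z => |Real.log ‖f z‖|) 0 r ≤ |α| * Real.log r + C := by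
  classical
  obtain ⟨C, h₀, hC, hh₀, H⟩ := hf.exists_abs_log_sub_le hnf
  obtain ⟨K, r₀, hK, hr₀, HK⟩ := hf.exists_sum_ord_annulus_le hβ hnf
  have hsmall : ∀ᶠ r : ℝ in atTop, r ^ (-(1 + β)) ≤ 1 / 2 :=
    (tendsto_rpow_neg_atTop (by linarith : 0 < 1 + β)).eventually_le_const (by norm_num)
  obtain ⟨r₁, hr₁⟩ := eventually_atTop.mp hsmall
  refine ⟨C + 9 * K, max (max h₀ r₀) r₁, le_max_of_le_left (le_max_of_le_left hh₀),
    fun r hr => ?_⟩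
  have hrh : h₀ ≤ r := (le_max_left _ _).trans ((le_max_left _ _).trans hr)
  have hrr : r₀ ≤ r := (le_max_right _ _).trans ((le_max_left _ _).trans hr)
  have hr0 : 0 < r := by linarith
  set δ := r ^ (-β) with hδ
  have hδ0 : 0 < δ := by positivity
  have hδr : δ ≤ r / 2 := by
    have h1 : δ = r ^ (-(1 + β)) * r := by
      rw [← Real.rpow_add_one hr0.ne', hδ]
      congr 1
      ring
    rw [h1]
    nlinarith [hr₁ r ((le_max_right _ _).trans hr)]
  set S := (zerosPoles f 0 (r + δ)).filter fun u => r - δ ≤ ‖u‖ with hS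
  have hSmem : ∀ u ∈ S, r - δ ≤ ‖u‖ ∧ ‖u‖ ≤ r + δ := by
    intro u hu
    rw [hS, Finset.mem_filter, mem_zerosPoles hf.meromorphic, sub_zero] at hu
    exact ⟨hu.2, hu.1.1⟩
  have hker : ∀ u : ℂ, ∃ Φ : ℂ → ℝ, ‖u‖ ≤ r + δ → CircleIntegrable Φ 0 r ∧
      (∀ z, ‖z‖ = r → z ≠ u → 0 ≤ Φ z ∧ Real.log (δ / ‖u - z‖) ≤ Φ z) ∧
      Real.circleAverage Φ 0 r ≤ 3 * (δ / r) := by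
    intro u
    by_cases hu : ‖u‖ ≤ r + δ
    · obtain ⟨Φ, hΦ⟩ := exists_log_kernel hδ0 (by linarith) hu
      exact ⟨Φ, fun _ => hΦ⟩
    · exact ⟨0, fun h => absurd h hu⟩
  choose Φ hΦ using hker
  have hcount : ∑ u ∈ S, |(ord f u : ℝ)| ≤ 3 * K * r ^ (β + 1) := by
    refine (HK r (r - δ) (r + δ) hrr (by linarith) (by linarith) (by linarith) S hSmem).trans_eq ?_
    have h1 : δ * r ^ β = 1 := by
      rw [hδ, ← Real.rpow_add hr0]
      simp
    linear_combination 2 * K * r ^ (β + 1) * h1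
  have hterm : ∀ u ∈ S, CircleIntegrable (fun z => |(ord f u : ℝ)| * Φ u z) 0 r := fun u hu =>
    ((hΦ u (hSmem u hu).2).1).const_mul _
  have hintS : CircleIntegrable (fun z => ∑ u ∈ S, |(ord f u : ℝ)| * Φ u z) 0 r :=
    CircleIntegrable.fun_sum S hterm
  have hpt : ∀ᶠ z in codiscreteWithin (sphere (0 : ℂ) r), |Real.log ‖f z‖| ≤
      (|α| * Real.log r + C) + ∑ u ∈ S, |(ord f u : ℝ)| * Φ u z := by
    filter_upwards [eventually_ne_zero hf.meromorphic hf.order_ne_top 0 r,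
      self_mem_codiscreteWithin (sphere (0 : ℂ) r)] with z hz hzr
    rw [mem_sphere_zero_iff_norm] at hzr
    obtain ⟨hza, hz0⟩ := hz
    have h1 := H z (by rw [hzr]; exact hrh) hza hz0
    rw [hzr, ← hδ] at h1
    have hne : ∀ u, ord f u ≠ 0 → z ≠ u := by
      rintro u hu rfl
      exact hu (ord_eq_zero_of_ne_zero hza hz0)
    have hsub : zerosPoles f z δ ⊆ S := by
      intro u hu
      rw [mem_zerosPoles hf.meromorphic] at hu
      rw [hS, Finset.mem_filter, mem_zerosPoles hf.meromorphic, sub_zero]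
      have h2 := norm_sub_norm_le u z
      have h3 := norm_sub_norm_le z u
      rw [norm_sub_rev] at h3
      exact ⟨⟨by linarith [hu.1], hu.2⟩, by linarith [hu.1]⟩
    have hSne : ∀ u ∈ S, z ≠ u := by
      intro u hu
      rw [hS, Finset.mem_filter, mem_zerosPoles hf.meromorphic] at hu
      exact hne u hu.1.2
    have h2 : ∑ u ∈ zerosPoles f z δ, |(ord f u : ℝ)| * Real.log (δ / ‖u - z‖) ≤
        ∑ u ∈ S, |(ord f u : ℝ)| * Φ u z := by
      refine (Finset.sum_le_sum fun u hu => ?_).trans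
        (Finset.sum_le_sum_of_subset_of_nonneg hsub fun u hu _ => ?_)
      · have huS := hsub hu
        exact mul_le_mul_of_nonneg_left ((hΦ u (hSmem u huS).2).2.1 z hzr (hSne u huS)).2
          (abs_nonneg _)
      · exact mul_nonneg (abs_nonneg _) ((hΦ u (hSmem u hu).2).2.1 z hzr (hSne u hu)).1
    have h3 : |α * Real.log r| = |α| * Real.log r := by
      rw [abs_mul, abs_of_nonneg (Real.log_nonneg (by linarith))]
    have h4 := abs_sub_abs_le_abs_sub (Real.log ‖f z‖) (α * Real.log r)
    rw [h3] at h4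
    linarith
  refine (circleAverage_le_of_codiscrete hr0 (circleIntegrable_log hf.meromorphic 0 r).abs
    ((circleIntegrable_const _ _ _).add hintS) hpt).trans ?_
  rw [Real.circleAverage_add (circleIntegrable_const _ _ _) hintS, Real.circleAverage_const,
    Real.circleAverage_fun_sum hterm]
  have h5 : ∑ u ∈ S, Real.circleAverage (fun z => |(ord f u : ℝ)| * Φ u z) 0 r ≤
      ∑ u ∈ S, |(ord f u : ℝ)| * (3 * (δ / r)) := by
    refine Finset.sum_le_sum fun u hu => ?_
    have := Real.circleAverage_fun_smul (a := |(ord f u : ℝ)|) (f := Φ u) (c := 0) (R := r)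
    simp only [smul_eq_mul] at this
    rw [this]
    exact mul_le_mul_of_nonneg_left (hΦ u (hSmem u hu).2).2.2 (abs_nonneg _)
  rw [← Finset.sum_mul] at h5
  have h6 : (∑ u ∈ S, |(ord f u : ℝ)|) * (3 * (δ / r)) ≤ 3 * K * r ^ (β + 1) * (3 * (δ / r)) := by
    gcongr
  have h7 : r ^ (β + 1) * (δ / r) = 1 := by
    rw [hδ, Real.rpow_add_one hr0.ne', Real.rpow_neg hr0.le]
    field_simp
  have h8 : 3 * K * r ^ (β + 1) * (3 * (δ / r)) = 9 * K := by linear_combination 9 * K * h7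
  linarith

end Yosida

namespace Yosida
open Filter Topology Metric Set

/-! ### Growth of the counting function of the poles -/

variable {f : ℂ → ℂ} {α β : ℝ}

/-- The multiplicity of `u` as a pole of `f`. -/
noncomputable def poleMult (f : ℂ → ℂ) (u : ℂ) : ℝ := ((ord f u)⁻ : ℤ)

/-- The number of poles of `f` in the closed disc about `0` of radius `r`, with multiplicities. -/
noncomputable def poleCount (f : ℂ → ℂ) (r : ℝ) : ℝ := ∑ u ∈ zerosPoles f 0 r, poleMult f u

theorem poleMult_nonneg (f : ℂ → ℂ) (u : ℂ) : 0 ≤ poleMult f u := by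
  rw [poleMult]
  exact_mod_cast negPart_nonneg _

theorem poleMult_le_abs (f : ℂ → ℂ) (u : ℂ) : poleMult f u ≤ |(ord f u : ℝ)| := by
  rw [poleMult]
  have : (ord f u)⁻ ≤ |ord f u| := by
    rw [← posPart_add_negPart]
    linarith [posPart_nonneg (ord f u)]
  exact_mod_cast this

theorem one_le_poleMult {u : ℂ} (h : ord f u < 0) : 1 ≤ poleMult f u := by
  rw [poleMult]
  have : 1 ≤ (ord f u)⁻ := by
    rw [negPart_eq_neg.mpr h.le]
    omega
  exact_mod_cast this

theorem zerosPoles_mono (hm : Meromorphic f) {c : ℂ} {r R : ℝ} (h : r ≤ R) :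
    zerosPoles f c r ⊆ zerosPoles f c R := by
  intro u hu
  rw [mem_zerosPoles hm] at hu ⊢
  exact ⟨hu.1.trans h, hu.2⟩

/-- The integrated counting function as a finite sum. The summand at the origin vanishes, because
`r / 0 = 0` and `log 0 = 0`; the last term accounts for a pole at the origin. -/
theorem N_eq_sum (hm : Meromorphic f) {r : ℝ} (hr : 0 < r) :
    N r f = ∑ u ∈ zerosPoles f 0 r, poleMult f u * Real.log (r / ‖u‖) +
      poleMult f 0 * Real.log r := by
  have hmo : MeromorphicOn f univ := meromorphicOn_univ.mpr hm
  have hdiv : ∀ u, MeromorphicOn.divisor f univ u = ord f u := fun u =>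
    MeromorphicOn.divisor_apply hmo (mem_univ u)
  rw [N, ValueDistribution.logCounting_top]
  change ∑ᶠ z, (Function.locallyFinsuppWithin.toClosedBall r
    (MeromorphicOn.divisor f univ)⁻ z : ℝ) * Real.log (r * ‖z‖⁻¹) +
    ((MeromorphicOn.divisor f univ)⁻ 0 : ℝ) * Real.log r = _
  rw [Function.locallyFinsuppWithin.negPart_apply, hdiv]
  congr 1
  have hmem : ∀ u : ℂ, ‖u‖ ≤ r → Function.locallyFinsuppWithin.toClosedBall r
      (MeromorphicOn.divisor f univ)⁻ u = (ord f u)⁻ := by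
    intro u hu
    rw [Function.locallyFinsuppWithin.toClosedBall_eval_within _
      (by rwa [abs_of_pos hr, mem_closedBall_zero_iff]),
      Function.locallyFinsuppWithin.negPart_apply, hdiv]
  rw [finsum_eq_sum_of_support_subset (s := zerosPoles f 0 r)]
  · refine Finset.sum_congr rfl fun u hu => ?_
    have h1 := ((mem_zerosPoles hm).mp hu).1
    rw [sub_zero] at h1
    rw [hmem u h1, ← div_eq_mul_inv]
    rfl
  · intro u hu
    have h0 : Function.locallyFinsuppWithin.toClosedBall r
        (MeromorphicOn.divisor f univ)⁻ u ≠ 0 := by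
      intro h0
      simp [h0] at hu
    have h1 : ‖u‖ ≤ r := by
      have := Function.locallyFinsuppWithin.toClosedBall_support_subset_closedBall _ h0
      rwa [abs_of_pos hr, mem_closedBall_zero_iff] at this
    rw [Finset.mem_coe, mem_zerosPoles hm, sub_zero]
    refine ⟨h1, fun h2 => h0 ?_⟩
    rw [hmem u h1, h2]
    simp

theorem log_div_norm_nonneg {r : ℝ} {u : ℂ} (hu : ‖u‖ ≤ r) : 0 ≤ Real.log (r / ‖u‖) := by
  rcases (norm_nonneg u).eq_or_lt with h | h
  · rw [← h]; simp
  · exact Real.log_nonneg ((one_le_div h).mpr hu)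

/-- A monotone function whose increments over dyadic intervals are `O(r ^ s)` is `O(r ^ s)`. -/
theorem exists_le_rpow_of_doubling {φ : ℝ → ℝ} {r₀ C s : ℝ} (hr₀ : 1 ≤ r₀) (hs : 0 < s)
    (hmono : MonotoneOn φ (Ici r₀)) (h : ∀ r, r₀ ≤ r → φ (2 * r) ≤ φ r + C * r ^ s) :
    ∃ A, 0 ≤ A ∧ ∀ r, r₀ ≤ r → φ r ≤ A * r ^ s := by
  have h2s : 1 < (2 : ℝ) ^ s := Real.one_lt_rpow (by norm_num) hs
  set A := max |φ (2 * r₀)| (C / (2 ^ s - 1)) with hA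
  have hA0 : 0 ≤ A := le_max_of_le_left (abs_nonneg _)
  have hAC : A + C ≤ A * 2 ^ s := by
    have h1 : C / (2 ^ s - 1) ≤ A := le_max_right _ _
    rw [div_le_iff₀ (by linarith)] at h1
    linarith
  have hbase : ∀ r, r₀ ≤ r → r ≤ 2 * r₀ → φ r ≤ A * r ^ s := by
    intro r h1 h2
    have h3 := hmono (mem_Ici.mpr h1) (mem_Ici.mpr (by linarith)) h2
    have h4 : |φ (2 * r₀)| ≤ A := le_max_left _ _
    have h5 : 1 ≤ r ^ s := Real.one_le_rpow (by linarith) hs.le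
    calc φ r ≤ A := h3.trans ((le_abs_self _).trans h4)
      _ ≤ A * r ^ s := le_mul_of_one_le_right hA0 h5
  have hind : ∀ k : ℕ, ∀ r, r₀ ≤ r → r ≤ 2 ^ (k + 1) * r₀ → φ r ≤ A * r ^ s := by
    intro k
    induction k with
    | zero => intro r h1 h2; exact hbase r h1 (by simpa using h2)
    | succ k ih =>
      intro r h1 h2
      rcases le_total r (2 * r₀) with h3 | h3
      · exact hbase r h1 h3
      · have h4 := ih (r / 2) (by linarith) (by rw [pow_succ] at h2; linarith)
        have h5 := h (r / 2) (by linarith)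
        rw [mul_div_cancel₀ r two_ne_zero] at h5
        have h6 : r ^ s = 2 ^ s * (r / 2) ^ s := by
          rw [← Real.mul_rpow (by norm_num) (by linarith)]
          congr 1
          ring
        have h7 : 0 ≤ (r / 2) ^ s := Real.rpow_nonneg (by linarith) s
        rw [h6]
        nlinarith
  refine ⟨A, hA0, fun r hr => ?_⟩
  obtain ⟨k, hk⟩ := pow_unbounded_of_one_lt r (one_lt_two (α := ℝ))
  refine hind k r hr ?_
  calc r ≤ 2 ^ k := hk.le
    _ ≤ 2 ^ (k + 1) * 1 := by rw [mul_one]; exact pow_le_pow_right₀ (by norm_num) (by omega)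
    _ ≤ 2 ^ (k + 1) * r₀ := by gcongr

theorem poleCount_mono (hm : Meromorphic f) : Monotone (poleCount f) := fun _ _ h =>
  Finset.sum_le_sum_of_subset_of_nonneg (zerosPoles_mono hm h) fun u _ _ => poleMult_nonneg f u

theorem N_two_mul_le (hm : Meromorphic f) {r : ℝ} (hr : 1 ≤ r) :
    N (2 * r) f ≤ N r f + Real.log 2 * (poleCount f (2 * r) + poleMult f 0) := by
  classical
  have hr0 : 0 < r := by linarith
  rw [N_eq_sum hm hr0, N_eq_sum hm (by linarith : 0 < 2 * r),
    Real.log_mul two_ne_zero hr0.ne']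
  have hlog2 : 0 < Real.log 2 := Real.log_pos (by norm_num)
  have hsub := zerosPoles_mono hm (c := 0) (by linarith : r ≤ 2 * r)
  have h1 : ∑ u ∈ zerosPoles f 0 r, poleMult f u * Real.log (r / ‖u‖) =
      ∑ u ∈ zerosPoles f 0 (2 * r),
        if u ∈ zerosPoles f 0 r then poleMult f u * Real.log (r / ‖u‖) else 0 := by
    rw [Finset.sum_ite_mem, Finset.inter_eq_right.mpr hsub]
  have h2 : ∑ u ∈ zerosPoles f 0 (2 * r), poleMult f u * Real.log (2 * r / ‖u‖) ≤
      ∑ u ∈ zerosPoles f 0 r, poleMult f u * Real.log (r / ‖u‖) +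
        poleCount f (2 * r) * Real.log 2 := by
    rw [h1, poleCount, Finset.sum_mul, ← Finset.sum_add_distrib]
    refine Finset.sum_le_sum fun u hu => ?_
    have hp := poleMult_nonneg f u
    have hu2 := (mem_zerosPoles hm).mp hu
    rw [sub_zero] at hu2
    rcases (norm_nonneg u).eq_or_lt with h | h
    · rw [← h]
      simp only [div_zero, Real.log_zero, mul_zero, ite_self]
      positivity
    · split_ifs with hur
      · rw [mul_div_assoc, Real.log_mul two_ne_zero (by positivity)]
        linarith
      · rw [zero_add]
        refine mul_le_mul_of_nonneg_left (Real.log_le_log (by positivity) ?_) hp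
        rw [div_le_iff₀ h]
        have : ¬ ‖u‖ ≤ r := fun hc => hur ((mem_zerosPoles hm).mpr ⟨by simpa using hc, hu2.2⟩)
        linarith
  linarith

theorem N_monotoneOn (f : ℂ → ℂ) : MonotoneOn (fun r => N r f) (Ioi 0) := by
  have := Function.locallyFinsuppWithin.logCounting_mono (D := (MeromorphicOn.divisor f univ)⁻)
    (negPart_nonneg _)
  intro x hx y hy hxy
  simp only [N, ValueDistribution.logCounting_top]
  exact this hx hy hxy

/-- Upper bound for the counting function: the annuli `r ≤ ‖z‖ ≤ 2 * r` contain
`O(r ^ (2 * β + 2))` poles. -/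
theorem GeneralisedYosida.exists_N_le (hβ : -1 < β) (hf : GeneralisedYosida α β f)
    (hnf : ∀ z, MeromorphicNFAt f z) :
    ∃ A r₀ : ℝ, 0 ≤ A ∧ 1 ≤ r₀ ∧ ∀ r, r₀ ≤ r → N r f ≤ A * r ^ (2 * β + 2) := by
  classical
  have hm := hf.meromorphic
  obtain ⟨K, r₀, hK, hr₀, H⟩ := hf.exists_sum_ord_annulus_le hβ hnf
  have hs : 0 < 2 * β + 2 := by linarith
  have hlog2 : 0 < Real.log 2 := Real.log_pos (by norm_num)
  have hcount : ∀ r, r₀ ≤ r → poleCount f (2 * r) ≤ poleCount f r + 2 * K * r ^ (2 * β + 2) := by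
    intro r hr
    have hr0 : 0 < r := by linarith
    have hsub := zerosPoles_mono hm (c := 0) (by linarith : r ≤ 2 * r)
    have h1 : poleCount f (2 * r) =
        ∑ u ∈ zerosPoles f 0 (2 * r) \ zerosPoles f 0 r, poleMult f u + poleCount f r :=
      (Finset.sum_sdiff hsub).symm
    have h2 := H r r (2 * r) hr (by linarith) (by linarith) le_rfl
      (zerosPoles f 0 (2 * r) \ zerosPoles f 0 r) (by
        intro u hu
        rw [Finset.mem_sdiff, mem_zerosPoles hm, mem_zerosPoles hm, sub_zero] at hu
        refine ⟨?_, hu.1.1⟩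
        by_contra hc
        exact hu.2 ⟨(not_le.mp hc).le, hu.1.2⟩)
    have h3 := Finset.sum_le_sum fun u
      (_ : u ∈ zerosPoles f 0 (2 * r) \ zerosPoles f 0 r) => poleMult_le_abs f u
    have h4 : 1 ≤ r ^ (β + 1) := Real.one_le_rpow (by linarith) (by linarith)
    have h5 : (2 * r - r) * r ^ β = r ^ (β + 1) := by
      rw [Real.rpow_add_one hr0.ne']
      ring
    have h6 : r ^ (2 * β + 2) = r ^ (β + 1) * r ^ (β + 1) := by
      rw [← Real.rpow_add hr0]
      congr 1
      ring
    rw [h5] at h2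
    have h7 : K * (r ^ (β + 1) + 1) * r ^ (β + 1) ≤ 2 * K * r ^ (2 * β + 2) := by
      rw [h6]
      calc K * (r ^ (β + 1) + 1) * r ^ (β + 1)
          ≤ K * (r ^ (β + 1) + r ^ (β + 1)) * r ^ (β + 1) := by gcongr
        _ = _ := by ring
    linarith
  obtain ⟨A, hA, hAle⟩ := exists_le_rpow_of_doubling hr₀ hs
    ((poleCount_mono hm).monotoneOn _) hcount
  set C := Real.log 2 * (A * 2 ^ (2 * β + 2) + poleMult f 0) with hC
  have hN : ∀ r, r₀ ≤ r → N (2 * r) f ≤ N r f + C * r ^ (2 * β + 2) := by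
    intro r hr
    have hr0 : 0 < r := by linarith
    have h1 := N_two_mul_le hm (by linarith : 1 ≤ r)
    have h2 := hAle (2 * r) (by linarith)
    rw [Real.mul_rpow (by norm_num) hr0.le] at h2
    have h3 : 1 ≤ r ^ (2 * β + 2) := Real.one_le_rpow (by linarith) hs.le
    have h4 := poleMult_nonneg f 0
    refine h1.trans (add_le_add le_rfl ?_)
    rw [hC, mul_assoc]
    refine mul_le_mul_of_nonneg_left ?_ hlog2.le
    nlinarith
  obtain ⟨A', hA', hle⟩ := exists_le_rpow_of_doubling (φ := fun r => N r f) hr₀ hs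
    ((N_monotoneOn f).mono fun x hx => lt_of_lt_of_le (by linarith) (mem_Ici.mp hx)) hN
  exact ⟨A', r₀, hA', hr₀, hle⟩

/-- Poles in an annulus contribute to the counting function at twice the outer radius. -/
theorem card_mul_log_two_le_N (hm : Meromorphic f) {r : ℝ} (hr : 1 ≤ r) {S : Finset ℂ}
    (hS : ∀ u ∈ S, u ≠ 0 ∧ ‖u‖ ≤ r ∧ ord f u < 0) : S.card * Real.log 2 ≤ N (2 * r) f := by
  rw [N_eq_sum hm (by linarith)]
  have hsub : S ⊆ zerosPoles f 0 (2 * r) := by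
    intro u hu
    rw [mem_zerosPoles hm, sub_zero]
    exact ⟨by linarith [(hS u hu).2.1], (hS u hu).2.2.ne⟩
  have h0 : 0 ≤ poleMult f 0 * Real.log (2 * r) :=
    mul_nonneg (poleMult_nonneg f 0) (Real.log_nonneg (by linarith))
  have hlog2 : 0 < Real.log 2 := Real.log_pos (by norm_num)
  have h1 : ∑ u ∈ S, Real.log 2 ≤ ∑ u ∈ S, poleMult f u * Real.log (2 * r / ‖u‖) := by
    refine Finset.sum_le_sum fun u hu => ?_
    obtain ⟨hu0, hur, huo⟩ := hS u hu
    have hu0' : 0 < ‖u‖ := norm_pos_iff.mpr hu0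
    have h2 := one_le_poleMult huo
    have h3 : Real.log 2 ≤ Real.log (2 * r / ‖u‖) := by
      refine Real.log_le_log (by norm_num) ?_
      rw [le_div_iff₀ hu0']
      linarith
    nlinarith
  have h2 := Finset.sum_le_sum_of_subset_of_nonneg hsub
    (f := fun u => poleMult f u * Real.log (2 * r / ‖u‖)) fun u hu _ =>
      mul_nonneg (poleMult_nonneg f u) (log_div_norm_nonneg (by
        simpa using ((mem_zerosPoles hm).mp hu).1))
  rw [Finset.sum_const, nsmul_eq_mul] at h1
  linarith

/-- Lower bound for the counting function: a square grid of mesh comparable with `r ^ (-β)` in the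
annulus `r ≤ ‖z‖ ≤ 2 * r` gives rise to distinct poles near the grid points. -/
theorem GeneralisedYosida.exists_le_N (hβ : -1 < β) (hf : GeneralisedYosida α β f)
    (hnf : ∀ z, MeromorphicNFAt f z) :
    ∃ c r₀ : ℝ, 0 < c ∧ 1 ≤ r₀ ∧ ∀ r, r₀ ≤ r → c * r ^ (2 * β + 2) ≤ N r f := by
  classical
  have hm := hf.meromorphic
  obtain ⟨R, h₀, hR, hh₀, H⟩ := hf.exists_pole_near hβ hnf
  have hlog2 : 0 < Real.log 2 := Real.log_pos (by norm_num)
  have h2β : (0 : ℝ) < 2 ^ |(-β)| := by positivity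
  set κ : ℝ := 3 * R * 2 ^ |(-β)| with hκ
  have hκ0 : 0 < κ := by positivity
  have hsmall : ∀ᶠ r : ℝ in atTop, r ^ (-(1 + β)) ≤ 3 / (4 * κ) :=
    (tendsto_rpow_neg_atTop (by linarith : 0 < 1 + β)).eventually_le_const (by positivity)
  obtain ⟨r₁, hr₁⟩ := eventually_atTop.mp hsmall
  have key : ∀ r, max h₀ r₁ ≤ r → (4 * κ)⁻¹ ^ 2 * r ^ (2 * β + 2) * Real.log 2 ≤ N (4 * r) f := by
    intro r hr
    have hrh : h₀ ≤ r := (le_max_left _ _).trans hr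
    have hr0 : 0 < r := by linarith
    set σ : ℝ := κ * r ^ (-β) with hσ
    have hσ0 : 0 < σ := by positivity
    have hσr : σ / 3 ≤ r / 4 := by
      have h1 : r ^ (-β) = r ^ (-(1 + β)) * r := by
        rw [← Real.rpow_add_one hr0.ne']
        congr 1
        ring
      have h2 := hr₁ r ((le_max_right _ _).trans hr)
      rw [le_div_iff₀ (by positivity)] at h2
      rw [hσ, h1]
      nlinarith
    set L := ⌊r / (4 * σ)⌋₊ with hL
    -- the grid points
    let P : ℕ × ℕ → ℂ := fun p => ⟨5 / 4 * r + p.1 * σ, p.2 * σ⟩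
    have hidx : ∀ i ∈ Finset.range (L + 1), (i : ℝ) * σ ≤ r / 4 := by
      intro i hi
      have h1 : i ≤ L := by rw [Finset.mem_range] at hi; omega
      have h2 : (i : ℝ) ≤ L := by exact_mod_cast h1
      have h3 : (L : ℝ) ≤ r / (4 * σ) := Nat.floor_le (by positivity)
      have h4 : (i : ℝ) ≤ r / (4 * σ) := h2.trans h3
      rw [le_div_iff₀ (by positivity)] at h4
      linarith
    set G := Finset.range (L + 1) ×ˢ Finset.range (L + 1) with hG
    have hP : ∀ p ∈ G, 5 / 4 * r ≤ ‖P p‖ ∧ ‖P p‖ ≤ 7 / 4 * r := by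
      intro p hp
      rw [hG, Finset.mem_product] at hp
      have h1 := hidx _ hp.1
      have h2 := hidx _ hp.2
      have h3 : (0 : ℝ) ≤ p.1 * σ := by positivity
      have h4 : (0 : ℝ) ≤ p.2 * σ := by positivity
      constructor
      · have := Complex.abs_re_le_norm (P p)
        have h5 := le_abs_self (P p).re
        have h6 : (P p).re = 5 / 4 * r + p.1 * σ := rfl
        linarith
      · have := Complex.norm_le_abs_re_add_abs_im (P p)
        have h6 : |(P p).re| = 5 / 4 * r + p.1 * σ := abs_of_nonneg (by positivity)
        have h7 : |(P p).im| = p.2 * σ := abs_of_nonneg (by positivity)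
        linarith
    have hpole : ∀ p, ∃ w, p ∈ G → ‖w - P p‖ ≤ σ / 3 ∧ ord f w < 0 := by
      intro p
      by_cases hp : p ∈ G
      · obtain ⟨h1, h2⟩ := hP p hp
        obtain ⟨w, hw, hwo⟩ := H (P p) (by linarith)
        refine ⟨w, fun _ => ⟨hw.trans ?_, hwo⟩⟩
        have h3 := rpow_le_two_rpow_abs_mul (-β) hr0 (by linarith : r / 2 ≤ ‖P p‖) (by linarith)
        calc R * ‖P p‖ ^ (-β) ≤ R * (2 ^ |(-β)| * r ^ (-β)) := by gcongr
          _ = σ / 3 := by rw [hσ, hκ]; ring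
      · exact ⟨0, fun h => absurd h hp⟩
    choose w hw using hpole
    have hinj : Set.InjOn w G := by
      intro p hp q hq hpq
      have h1 := (hw p hp).1
      have h2 := (hw q hq).1
      rw [hpq] at h1
      have h3 : ‖P p - P q‖ ≤ 2 * σ / 3 := by
        have := norm_sub_le (w q - P q) (w q - P p)
        rw [sub_sub_sub_cancel_left] at this
        linarith
      have hcoord : ∀ i j : ℕ, |((i : ℝ) - j) * σ| ≤ 2 * σ / 3 → i = j := by
        intro i j hij
        rw [abs_mul, abs_of_pos hσ0] at hij
        have h4 : |(i : ℝ) - j| < 1 := by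
          by_contra hc
          nlinarith [not_lt.mp hc]
        have h5 : |(i : ℤ) - j| < 1 := by exact_mod_cast h4
        rw [Int.abs_lt_one_iff] at h5
        omega
      have hre := (Complex.abs_re_le_norm (P p - P q)).trans h3
      have him := (Complex.abs_im_le_norm (P p - P q)).trans h3
      have e1 : (P p - P q).re = ((p.1 : ℝ) - q.1) * σ := by
        rw [Complex.sub_re]
        change (5 / 4 * r + p.1 * σ) - (5 / 4 * r + q.1 * σ) = _
        ring
      have e2 : (P p - P q).im = ((p.2 : ℝ) - q.2) * σ := by
        rw [Complex.sub_im]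
        change (p.2 : ℝ) * σ - q.2 * σ = _
        ring
      rw [e1] at hre
      rw [e2] at him
      exact Prod.ext (hcoord _ _ hre) (hcoord _ _ him)
    have hcard : ((G.image w).card : ℝ) = ((L : ℝ) + 1) ^ 2 := by
      rw [Finset.card_image_of_injOn hinj, hG, Finset.card_product, Finset.card_range]
      push_cast
      ring
    have h1 := card_mul_log_two_le_N hm (by linarith : 1 ≤ 2 * r) (S := G.image w) (by
      intro u hu
      obtain ⟨p, hp, rfl⟩ := Finset.mem_image.mp hu
      obtain ⟨ha, hb⟩ := hP p hp
      obtain ⟨hc, hd⟩ := hw p hp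
      have h2 := norm_sub_norm_le (P p) (w p)
      rw [norm_sub_rev] at h2
      have h3 := norm_sub_norm_le (w p) (P p)
      refine ⟨norm_pos_iff.mp (by linarith), by linarith, hd⟩)
    rw [hcard] at h1
    have h2 : (4 * κ)⁻¹ ^ 2 * r ^ (2 * β + 2) = (r / (4 * σ)) ^ 2 := by
      have h3 : r ^ (2 * β + 2) = (r ^ β * r) ^ 2 := by
        rw [← Real.rpow_add_one hr0.ne', ← Real.rpow_natCast, ← Real.rpow_mul hr0.le]
        congr 1
        push_cast
        ring
      rw [h3, hσ, Real.rpow_neg hr0.le]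
      field_simp
    have h3 : r / (4 * σ) ≤ L + 1 := (Nat.lt_floor_add_one _).le
    have h4 : 4 * r = 2 * (2 * r) := by ring
    rw [h2, h4]
    refine le_trans ?_ h1
    gcongr
  refine ⟨(4 * κ)⁻¹ ^ 2 * (1 / 4) ^ (2 * β + 2) * Real.log 2, 4 * max h₀ r₁, by positivity, ?_,
    fun r hr => ?_⟩
  · have := le_max_left h₀ r₁
    linarith
  · have hr0 : 0 ≤ r := by
      have := le_max_left h₀ r₁
      linarith
    have h1 := key (r / 4) (by linarith)
    rw [mul_div_cancel₀ r four_ne_zero, div_eq_mul_one_div r 4,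
      Real.mul_rpow hr0 (by norm_num)] at h1
    linarith

end Yosida

namespace Yosida
open Filter Topology Metric Set

/-! ### Passage to the normal form and conclusion -/

variable {f : ℂ → ℂ} {α β : ℝ}

theorem toSphere_rescale_congr {f' : ℂ → ℂ} (hff : ∀ z, f =ᶠ[𝓝[≠] z] f') {h : ℂ} (hh : h ≠ 0) :
    toSphere (rescale α β f h) = toSphere (rescale α β f' h) := by
  funext z
  apply toSphere_congr
  have hd : h ^ (-(β : ℂ)) ≠ 0 := cpow_ne_zero_of_ne_zero hh _
  have ht : Tendsto (fun z => h + h ^ (-(β : ℂ)) * z) (𝓝[≠] z)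
      (𝓝[≠] (h + h ^ (-(β : ℂ)) * z)) := by
    refine tendsto_nhdsWithin_of_tendsto_nhds_of_eventually_within _ ?_ ?_
    · exact (analyticAt_add_mul h _ z).continuousAt.tendsto.mono_left nhdsWithin_le_nhds
    · filter_upwards [self_mem_nhdsWithin] with y hy hc
      exact hy (mul_left_cancel₀ hd (add_left_cancel hc))
  filter_upwards [ht.eventually (hff _)] with y hy
  rw [rescale, rescale, hy]

/-- Membership in the class depends only on the meromorphic function, not on its values on a discrete
set. -/
theorem GeneralisedYosida.congr (hf : GeneralisedYosida α β f) {f' : ℂ → ℂ} (hm' : Meromorphic f')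
    (hff : ∀ z, f =ᶠ[𝓝[≠] z] f') : GeneralisedYosida α β f' where
  meromorphic := hm'
  transcendental := by
    rintro ⟨p, q, hq, hpq⟩
    refine hf.transcendental ⟨p, q, hq, ?_⟩
    have h1 : f =ᶠ[codiscrete ℂ] f' := by
      refine mem_codiscreteWithin_iff_forall_mem_nhdsNE.mpr fun x _ => ?_
      filter_upwards [hff x] with w hw
      exact Or.inl hw
    exact h1.trans hpq
  normal := by
    intro F hF
    refine hf.normal F fun n => ?_
    obtain ⟨h, hh, hFn⟩ := hF n
    exact ⟨h, hh, hFn.trans (toSphere_rescale_congr hff (norm_pos_iff.mp (by linarith))).symm⟩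
  limit_nonconstant := by
    intro h g hh hg
    refine hf.limit_nonconstant h g hh fun K hK ε hε => ?_
    filter_upwards [hg K hK ε hε, hh.eventually_gt_atTop 0] with n hn hn0 z hz
    rw [toSphere_rescale_congr hff (norm_pos_iff.mp hn0)]
    exact hn z hz

theorem abs_log_eq_posLog_add (x : ℝ) : |Real.log x| = Real.posLog x + Real.posLog x⁻¹ := by
  rw [Real.posLog, Real.posLog, Real.log_inv]
  rcases le_total 0 (Real.log x) with h | h
  · rw [abs_of_nonneg h, max_eq_right h, max_eq_left (by linarith), add_zero]
  · rw [abs_of_nonpos h, max_eq_left h, max_eq_right (by linarith), zero_add]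

theorem m_add_m_inv (hm : Meromorphic f) (r : ℝ) :
    m r f + m r f⁻¹ = Real.circleAverage (fun z => |Real.log ‖f z‖|) 0 r := by
  rw [m, m, ValueDistribution.proximity_top, ValueDistribution.proximity_top,
    ← Real.circleAverage_fun_add hm.meromorphicOn.circleIntegrable_posLog_norm
      hm.inv.meromorphicOn.circleIntegrable_posLog_norm]
  congr 1
  funext z
  rw [abs_log_eq_posLog_add, Pi.inv_apply, norm_inv]

/-- The means of `|log ‖f‖|` are `O(log r)`, and the poles have the expected order of growth; here `f`
need not be in normal form. -/
theorem GeneralisedYosida.isBigO_and_isTheta (hβ : -1 < β) (hf : GeneralisedYosida α β f) :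
    (fun r : ℝ => m r f + m r f⁻¹) =O[atTop] Real.log ∧
      (fun r : ℝ => N r f) =Θ[atTop] fun r : ℝ => r ^ (2 * β + 2) := by
  have hmo : MeromorphicOn f univ := meromorphicOn_univ.mpr hf.meromorphic
  set f' := toMeromorphicNFOn f univ with hf'
  have hnf : ∀ z, MeromorphicNFAt f' z := fun z =>
    meromorphicNFOn_toMeromorphicNFOn f univ (mem_univ z)
  have hff : ∀ z, f =ᶠ[𝓝[≠] z] f' := fun z =>
    (hmo.toMeromorphicNFOn_eq_self_on_nhdsNE (mem_univ z)).symm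
  have hY : GeneralisedYosida α β f' := hf.congr (fun z => (hnf z).meromorphicAt) hff
  have hN : ∀ r, N r f = N r f' := by
    intro r
    rw [N, N, ValueDistribution.logCounting_top, ValueDistribution.logCounting_top, hf',
      MeromorphicOn.divisor_of_toMeromorphicNFOn hmo]
  constructor
  · obtain ⟨C, r₀, hr₀, H⟩ := hY.exists_circleAverage_abs_log_le hβ hnf
    refine Asymptotics.IsBigO.of_bound (|α| + |C|) ?_
    filter_upwards [eventually_ge_atTop r₀,
      Real.tendsto_log_atTop.eventually_ge_atTop 1] with r hr hlog
    have hr0 : 0 < r := by linarith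
    have h1 : Real.circleAverage (fun z => |Real.log ‖f z‖|) 0 r =
        Real.circleAverage (fun z => |Real.log ‖f' z‖|) 0 r := by
      refine Real.circleAverage_congr_codiscreteWithin ?_ hr0.ne'
      refine mem_codiscreteWithin_iff_forall_mem_nhdsNE.mpr fun x _ => ?_
      filter_upwards [hff x] with w hw
      left
      change |Real.log ‖f w‖| = |Real.log ‖f' w‖|
      rw [hw]
    have h2 : 0 ≤ m r f + m r f⁻¹ :=
      add_nonneg (ValueDistribution.proximity_nonneg r) (ValueDistribution.proximity_nonneg r)
    rw [Real.norm_of_nonneg h2, Real.norm_of_nonneg (by linarith), m_add_m_inv hf.meromorphic, h1]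
    have h3 := H r hr
    have h4 := le_abs_self C
    have h5 := abs_nonneg C
    nlinarith
  · obtain ⟨A, r₀, hA, hr₀, HA⟩ := hY.exists_N_le hβ hnf
    obtain ⟨c, r₁, hc, hr₁, Hc⟩ := hY.exists_le_N hβ hnf
    have hpos : ∀ r : ℝ, r₁ ≤ r → 0 ≤ r ^ (2 * β + 2) := fun r hr =>
      Real.rpow_nonneg (by linarith) _
    constructor
    · refine Asymptotics.IsBigO.of_bound A ?_
      filter_upwards [eventually_ge_atTop r₀, eventually_ge_atTop r₁] with r h0 h1
      have h2 := Hc r h1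
      have h3 : 0 ≤ c * r ^ (2 * β + 2) := mul_nonneg hc.le (hpos r h1)
      rw [hN, Real.norm_of_nonneg (by linarith), Real.norm_of_nonneg (hpos r h1)]
      exact HA r h0
    · refine Asymptotics.IsBigO.of_bound c⁻¹ ?_
      filter_upwards [eventually_ge_atTop r₁] with r h1
      have h2 := Hc r h1
      have h3 : 0 ≤ c * r ^ (2 * β + 2) := mul_nonneg hc.le (hpos r h1)
      rw [hN, Real.norm_of_nonneg (hpos r h1), Real.norm_of_nonneg (by linarith), inv_mul_eq_div,
        le_div_iff₀ hc, mul_comm]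
      exact h2

end Yosida

open Filter Asymptotics

theorem theorem11 (α β : ℝ) (hβ : -1 < β) (f : ℂ → ℂ) (hf : Yosida.GeneralisedYosida α β f) :
    (∀ r : ℝ, 0 < r →
      IntervalIntegrable (fun θ : ℝ => |Real.log ‖f (r * Complex.exp (θ * Complex.I))‖|)
        MeasureTheory.volume 0 (2 * Real.pi) ∧
      Yosida.m r f + Yosida.m r f⁻¹ =
        1 / (2 * Real.pi) *
          ∫ θ in (0 : ℝ)..(2 * Real.pi), |Real.log ‖f (r * Complex.exp (θ * Complex.I))‖|) ∧
    Asymptotics.IsBigO Filter.atTop (fun r : ℝ => Yosida.m r f + Yosida.m r f⁻¹)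
      (fun r : ℝ => Real.log r) ∧
    Asymptotics.IsEquivalent Filter.atTop (fun r : ℝ => Yosida.T r f)
      (fun r : ℝ => Yosida.N r f) ∧
    Asymptotics.IsEquivalent Filter.atTop (fun r : ℝ => Yosida.N r f)
      (fun r : ℝ => Yosida.N r f⁻¹) ∧
    Asymptotics.IsTheta Filter.atTop (fun r : ℝ => Yosida.N r f⁻¹)
      (fun r : ℝ => r ^ (2 * β + 2)) := by
  have hm := hf.meromorphic
  obtain ⟨hO, hΘ⟩ := hf.isBigO_and_isTheta hβ
  have hmap : ∀ r θ : ℝ, (r : ℂ) * Complex.exp (θ * Complex.I) = circleMap 0 r θ := fun r θ => by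
    rw [circleMap_zero]
  have hlog : (fun r : ℝ => Real.log r) =o[atTop] fun r : ℝ => r ^ (2 * β + 2) :=
    isLittleO_log_rpow_atTop (by linarith)
  have hmnn : ∀ (g : ℂ → ℂ) (r : ℝ), 0 ≤ Yosida.m r g := fun g r =>
    ValueDistribution.proximity_nonneg r
  have hmf : (fun r : ℝ => Yosida.m r f) =O[atTop] fun r : ℝ => Real.log r := by
    refine (IsBigO.of_bound 1 (Eventually.of_forall fun r => ?_)).trans hO
    rw [one_mul, Real.norm_of_nonneg (hmnn f r),
      Real.norm_of_nonneg (add_nonneg (hmnn f r) (hmnn f⁻¹ r))]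
    linarith [hmnn f⁻¹ r]
  have hmi : (fun r : ℝ => Yosida.m r f⁻¹) =O[atTop] fun r : ℝ => Real.log r := by
    refine (IsBigO.of_bound 1 (Eventually.of_forall fun r => ?_)).trans hO
    rw [one_mul, Real.norm_of_nonneg (hmnn f⁻¹ r),
      Real.norm_of_nonneg (add_nonneg (hmnn f r) (hmnn f⁻¹ r))]
    linarith [hmnn f r]
  have hlogN : (fun r : ℝ => Real.log r) =o[atTop] fun r : ℝ => Yosida.N r f :=
    hlog.trans_isTheta hΘ.symm
  have hTN : ∀ (g : ℂ → ℂ) (r : ℝ), Yosida.T r g = Yosida.m r g + Yosida.N r g := fun _ _ => rfl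
  have hT : (fun r : ℝ => Yosida.T r f - Yosida.T r f⁻¹) =O[atTop] fun r : ℝ => Real.log r := by
    have h1 : (1 : ℝ → ℝ) =O[atTop] fun r : ℝ => Real.log r :=
      (Real.isLittleO_const_log_atTop (c := (1 : ℝ))).isBigO
    exact (ValueDistribution.isBigO_characteristic_sub_characteristic_inv hm).trans h1
  have hNN : (fun r : ℝ => Yosida.N r f⁻¹ - Yosida.N r f) =o[atTop] fun r : ℝ => Yosida.N r f := by
    refine IsBigO.trans_isLittleO ?_ hlogN
    refine ((hmf.sub hmi).sub hT).congr_left fun r => ?_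
    rw [hTN, hTN]
    ring
  have hequiv : IsEquivalent atTop (fun r : ℝ => Yosida.N r f⁻¹) (fun r : ℝ => Yosida.N r f) := hNN
  refine ⟨fun r _ => ?_, hO, ?_, hequiv.symm, ?_⟩
  · simp only [hmap]
    refine ⟨(Yosida.circleIntegrable_log hm 0 r).abs, ?_⟩
    rw [Yosida.m_add_m_inv hm, Real.circleAverage_def, smul_eq_mul, one_div]
  · have h1 : (fun r : ℝ => Yosida.T r f - Yosida.N r f) =o[atTop] fun r : ℝ => Yosida.N r f := by
      refine (hmf.trans_isLittleO hlogN).congr_left fun r => ?_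
      rw [hTN]
      ring
    exact h1
  · exact hequiv.isTheta.trans hΘ
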